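/- **Conventions.** Digraphs are finite, with no loops and no two parallel arcs in the same direction (two arcs in opposite directions between the same two vertices are allowed). For a digraph $D$, $e(A,B)$ is the number of arcs directed from $A$ to $B$, and $e(A)=e(A,A)$. For a vertex $x$, $d^+(x)$ and $d^-(x)$ are its outdegree and indegree, $d(x)=d^+(x)+d^-(x)$, and $s(x)=\max\{d^+(x)-d^-(x),\,d^-(x)-d^+(x)\}$. Parts of a partition may be empty. Given a partition $X,Y$ of $V(D)$ and a partition $X_1,X_2$ of $X$, let $$\theta(X_1,X_2)=\bigl(e(X_1,Y)+e(Y,X_2)\bigr)-\bigl(e(X_2,Y)+e(Y,X_1)\bigr).$$ A connected graph is *tight* if all its blocks (maximal connected subgraphs without a cut vertex) are cliques of odd order. An *essential tight component* of a digraph is a connected component $T$ of its underlying simple graph such that $T$ is tight and the digraph has no two arcs in opposite directions between two vertices of $T$. **Proposition 4.3.** Let $d\ge 4$ be an integer and let $C,\varepsilon$ be positive reals. Then there exists $\gamma$ with $0<\gamma<\varepsilon$, depending only on $d$, $C$ and $\varepsilon$, such that the following holds. Let $D$ be a digraph with $n$ vertices, $m\le Cn$ arcs, and minimum outdegree at least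 $d$. Let $X,Y$ be a partition of $V(D)$ with $|X|\le\gamma n$, $e(X)=0$, and $d(y)\le\gamma n$ for all $y\in Y$. Let $\theta=\min\{|\theta(X_1,X_2)| : X_1,X_2 \text{ is a partition of } X\}$, $X'=\{x\in X : s(x)\ge\theta\}$ (the set of huge vertices), $g=\sum_{x\in X\setminus X'}s(x)$, and $2b=\sum_{x\in X}(d(x)-s(x))$. 1. If $|X'|\le d$, then $\tau\le (n+2g+2b)/(2d-2|X'|+1)$, where $\tau$ is the number of essential tight components of $D[Y]$. 2. If $|X'|=1$, then $V(D)$ admits a partition $V_1,V_2$ such that $$\min\{e(V_1,V_2),e(V_2,V_1)\}\ge\left(\frac{d-1}{2(2d-1)}-\varepsilon\right)m.$$ -/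

import Mathlib

namespace SimpleGraph

/-- `B` induces a connected subgraph (in particular `B` is nonempty) without a cut vertex:
deleting any one vertex of `B` never separates two of the remaining vertices of `B`. -/
def NonseparableOn {V : Type*} (G : SimpleGraph V) (B : Set V) : Prop :=
  (G.induce B).Connected ∧ ∀ v ∈ B, (G.induce (B \ {v})).Preconnected

/-- `B` is the vertex set of a block of `G`. A block is a maximal connected subgraph without a cut
vertex. By maximality it is an induced subgraph, so it is recorded by its vertex set. Isolated
vertices and bridges (with their two ends) are blocks. -/
def IsBlockOn {V : Type*} (G : SimpleGraph V) (B : Set V) : Prop :=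
  Maximal G.NonseparableOn B

/-- A graph is tight if it is connected and all its blocks are cliques of odd order. -/
def IsTight {V : Type*} (G : SimpleGraph V) : Prop :=
  G.Connected ∧ ∀ B : Set V, G.IsBlockOn B → G.IsClique B ∧ Odd B.ncard

end SimpleGraph

namespace Digraph

/-- The digraph has no loops. (Parallel arcs in the same direction do not exist in a `Digraph`;
two arcs in opposite directions between the same vertices are allowed.) -/
def Loopless {V : Type*} (D : Digraph V) : Prop := ∀ v, ¬ D.Adj v v

/-- The subgraph of `D` induced by a set of vertices. -/
def inducedOn {V : Type*} (D : Digraph V) (S : Set V) : Digraph S where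
  Adj u v := D.Adj u v

open Classical in
/-- `e(A, B)`: the number of arcs directed from `A` to `B`. -/
noncomputable def arcCount {V : Type*} (D : Digraph V) (A B : Finset V) : ℕ :=
  ((A ×ˢ B).filter fun p => D.Adj p.1 p.2).card

open Classical in
/-- The outdegree `d⁺(x)`. -/
noncomputable def outDeg {V : Type*} [Fintype V] (D : Digraph V) (x : V) : ℕ :=
  (Finset.univ.filter fun y => D.Adj x y).card

open Classical in
/-- The indegree `d⁻(x)`. -/
noncomputable def inDeg {V : Type*} [Fintype V] (D : Digraph V) (x : V) : ℕ :=
  (Finset.univ.filter fun y => D.Adj y x).card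

/-- The degree `d(x) = d⁺(x) + d⁻(x)`. -/
noncomputable def deg {V : Type*} [Fintype V] (D : Digraph V) (x : V) : ℕ :=
  D.outDeg x + D.inDeg x

/-- `s(x) = max {d⁺(x) - d⁻(x), d⁻(x) - d⁺(x)}`. -/
noncomputable def imbalance {V : Type*} [Fintype V] (D : Digraph V) (x : V) : ℤ :=
  max ((D.outDeg x : ℤ) - D.inDeg x) ((D.inDeg x : ℤ) - D.outDeg x)

/-- The gap `θ(X₁, X₂) = (e(X₁, Y) + e(Y, X₂)) - (e(X₂, Y) + e(Y, X₁))`. -/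
noncomputable def gap {V : Type*} (D : Digraph V) (Y X₁ X₂ : Finset V) : ℤ :=
  ((D.arcCount X₁ Y : ℤ) + D.arcCount Y X₂) - ((D.arcCount X₂ Y : ℤ) + D.arcCount Y X₁)

/-- `θ`: the minimum of `|θ(X₁, X₂)|` over all partitions `X₁, X₂` of `X`. -/
noncomputable def minGap {V : Type*} [DecidableEq V] (D : Digraph V) (X Y : Finset V) : ℤ :=
  X.powerset.inf' ⟨∅, Finset.empty_mem_powerset X⟩ fun X₁ => |D.gap Y X₁ (X \ X₁)|

/-- `X'`: the set of huge vertices in `X`, those with `s(x) ≥ θ`. -/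
noncomputable def huge {V : Type*} [Fintype V] [DecidableEq V] (D : Digraph V)
    (X Y : Finset V) : Finset V :=
  X.filter fun x => D.minGap X Y ≤ D.imbalance x

/-- `g`: the sum of `s(x)` over the vertices of `X` that are not huge. -/
noncomputable def smallSum {V : Type*} [Fintype V] [DecidableEq V] (D : Digraph V)
    (X Y : Finset V) : ℤ :=
  ∑ x ∈ X \ D.huge X Y, D.imbalance x

/-- The number `b` given by `2 b = ∑ x ∈ X, (d(x) - s(x))`. -/
noncomputable def balancedHalf {V : Type*} [Fintype V] (D : Digraph V) (X : Finset V) : ℝ :=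
  ((∑ x ∈ X, ((D.deg x : ℤ) - D.imbalance x) : ℤ) : ℝ) / 2

/-- A component of the underlying graph of `D` is an essential tight component of `D` if it is tight
and `D` has no two arcs in opposite directions between two of its vertices. -/
def IsEssentialTight {V : Type*} (D : Digraph V)
    (T : D.toSimpleGraphInclusive.ConnectedComponent) : Prop :=
  (D.toSimpleGraphInclusive.induce T.supp).IsTight ∧
    ∀ u ∈ T.supp, ∀ v ∈ T.supp, ¬ (D.Adj u v ∧ D.Adj v u)

/-- The number of essential tight components of `D`. -/
noncomputable def numEssentialTight {V : Type*} (D : Digraph V) : ℕ :=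
  {T : D.toSimpleGraphInclusive.ConnectedComponent | D.IsEssentialTight T}.ncard

end Digraph

/-! Both conclusions rest on counting arcs at the tight components of `D[Y]`. Let `T` be essential
tight with `t` vertices. It has no opposite arcs, so it spans at most `t(t-1)/2` arcs. Each vertex
sends at most `|X'|` arcs to huge vertices, and all its other out-arcs stay in `T` or enter `X \
X'`. Outdegree at least `d` then gives `t + 2e(T, X \ X') ≥ 2(d - |X'|) + 1`. Summing over all `T`,
and using that twice the indegree sum over `X \ X'` is at most `2g + 2b`, yields the bound on `τ`
(`numEssentialTight_mul_le`).

For the bipartition, the vertices of `Y` are partitioned into induced stars. A connected graph has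
such a partition of weight at least half its order unless it is tight with no double edge, and then
one half is lost (`CutConnected.surplus_or_oddCliqueTree`). So the total weight `k` satisfies `2k ≥
|Y| - τ`. Centre and leaves of a star get opposite signs, `X` is split so as to attain `θ`, and each
star is flipped as a unit. A random flip would cut `(m + k ± θ)/4` arcs in the two directions on
average. A greedy choice of flips does as well, and a quadratic penalty keeps the contribution of
`Y` to the imbalance small (`exists_bipartition`). High-degree leaves are detached beforehand, so
that every group has small total degree.

With a single huge vertex `x₀`, minimality of `θ` forces `θ + g ≤ s(x₀) ≤ |Y|`
(`minGap_add_smallSum_le`). Together with the bound on `τ` and `m ≥ b + d|Y|`, this gives `k - θ ≥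
-m/(2d-1)` up to a small error, which is the required constant. -/

namespace SimpleGraph

/-! ### Connected vertex sets and removable stars. -/

variable {V : Type*} [DecidableEq V] {G : SimpleGraph V} {w : V → V → ℕ}

/-- Every proper nonempty subset of the nonempty set `S` is left by an edge inside `S`. -/
def CutConnected (G : SimpleGraph V) (S : Finset V) : Prop :=
  S.Nonempty ∧ ∀ A ⊆ S, A.Nonempty → A ≠ S → ∃ a ∈ A, ∃ b ∈ S \ A, G.Adj a b

theorem CutConnected.union {S T : Finset V} (hS : G.CutConnected S) (hT : G.CutConnected T)
    {a b : V} (ha : a ∈ S) (hb : b ∈ T) (hab : G.Adj a b) : G.CutConnected (S ∪ T) := by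
  refine ⟨⟨a, by simp [ha]⟩, fun A hA hne hAS => ?_⟩
  by_cases h1 : (A ∩ S).Nonempty ∧ A ∩ S ≠ S
  · obtain ⟨x, hx, y, hy, hxy⟩ := hS.2 _ Finset.inter_subset_right h1.1 h1.2
    exact ⟨x, by grind, y, by grind, hxy⟩
  by_cases h2 : (A ∩ T).Nonempty ∧ A ∩ T ≠ T
  · obtain ⟨x, hx, y, hy, hxy⟩ := hT.2 _ Finset.inter_subset_right h2.1 h2.2
    exact ⟨x, by grind, y, by grind, hxy⟩
  rw [not_and_or, not_ne_iff, Finset.not_nonempty_iff_eq_empty] at h1 h2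
  rcases h1 with h1 | h1 <;> rcases h2 with h2 | h2
  · exfalso
    obtain ⟨x, hx⟩ := hne
    have : x ∈ A ∩ S ∨ x ∈ A ∩ T := by grind
    simp [h1, h2] at this
  · exact ⟨b, by grind, a, by
      have : a ∉ A := fun h => by
        have : a ∈ A ∩ S := by grind
        simp [h1] at this
      grind, hab.symm⟩
  · exact ⟨a, by grind, b, by
      have : b ∉ A := fun h => by
        have : b ∈ A ∩ T := by grind
        simp [h2] at this
      grind, hab⟩
  · exact absurd (by grind : A = S ∪ T) hAS

/-- This drives the induction on connected sets: an induced star can be peeled off without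
disconnecting the rest. The root `r` is kept in the remainder so that the recursion, run inside a
component of `S - r`, can be reattached through `r`. -/
theorem exists_terminal_star (S : Finset V) (hS : G.CutConnected S) (r : V) (hr : r ∈ S)
    (h2 : 2 ≤ S.card) :
    ∃ c ∈ S, ∃ L ⊆ S, L.Nonempty ∧ c ∉ L ∧ (∀ l ∈ L, G.Adj c l) ∧
      (∀ l ∈ L, ∀ l' ∈ L, ¬ G.Adj l l') ∧
      ((r ∈ S \ insert c L ∧ G.CutConnected (S \ insert c L)) ∨ S = insert c L) := by
  induction hn : S.card using Nat.strong_induction_on generalizing S r with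
  | _ n ih =>
  by_cases hind : ∀ x ∈ S.erase r, ∀ y ∈ S.erase r, ¬ G.Adj x y
  · refine ⟨r, hr, S.erase r, Finset.erase_subset _ _, ?_, by simp, fun l hl => ?_, hind,
      Or.inr (by rw [Finset.insert_erase hr])⟩
    · rw [← Finset.card_pos, Finset.card_erase_of_mem hr]; omega
    · obtain ⟨a, ha, b, hb, hab⟩ := hS.2 {l} (by grind) (by simp) (by
        rintro rfl; simp at h2)
      simp only [Finset.mem_singleton] at ha
      subst ha
      by_cases hbr : b = r
      · subst hbr; exact hab.symm
      · exact absurd hab (hind _ hl _ (by grind))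
  push Not at hind
  obtain ⟨x, hx, y, hy, hxy⟩ := hind
  classical
  -- A smallest subset of `S - r` that contains `x` and is closed under adjacency is the component
  -- of `x`; it also contains `y`, so it has at least two vertices.
  obtain ⟨A, hA, hmin⟩ := Finset.exists_min_image ((S.erase r).powerset.filter
    (fun A => x ∈ A ∧ ∀ a ∈ A, ∀ b ∈ S.erase r \ A, ¬ G.Adj a b)) Finset.card
    ⟨S.erase r, by simp only [Finset.mem_filter, Finset.mem_powerset]; grind⟩
  simp only [Finset.mem_filter, Finset.mem_powerset] at hA hmin
  obtain ⟨hAS, hxA, hcl⟩ := hA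
  have hyA : y ∈ A := by
    by_contra h
    exact hcl x hxA y (by grind) hxy
  have hrA : r ∉ A := fun h => by simpa using hAS h
  have hAconn : G.CutConnected A := by
    refine ⟨⟨x, hxA⟩, fun B hB hBn hBA => ?_⟩
    by_contra hcon
    push Not at hcon
    have hlt : B.card < A.card := Finset.card_lt_card (Finset.ssubset_iff_subset_ne.2 ⟨hB, hBA⟩)
    by_cases hxB : x ∈ B
    · have := hmin B ⟨hB.trans hAS, hxB, fun a ha b hb hab => by
        by_cases hbA : b ∈ A
        · exact hcon a ha b (by grind) hab
        · exact hcl a (hB ha) b (by grind) hab⟩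
      omega
    · have := hmin (A \ B) ⟨Finset.sdiff_subset.trans hAS, by grind, fun a ha b hb hab => by
        by_cases hbA : b ∈ A
        · exact hcon b (by grind) a (by grind) hab.symm
        · exact hcl a (by grind) b (by grind) hab⟩
      have h3 := Finset.card_sdiff_add_card_eq_card hB
      have := hBn.card_pos
      omega
  obtain ⟨a, ha, b, hb, hab⟩ := hS.2 A (by grind) ⟨x, hxA⟩ (by grind)
  have hbr : b = r := by
    by_contra h
    exact hcl a ha b (by grind) hab
  subst hbr
  have hrest : G.CutConnected (S \ A) := by
    refine ⟨⟨b, hb⟩, fun B hB hBn hBA => ?_⟩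
    by_cases hbB : b ∈ B
    · obtain ⟨p, hp, q, hq, hpq⟩ := hS.2 ((S \ A) \ B) (by grind)
        (Finset.sdiff_nonempty.2 fun h => hBA (Finset.Subset.antisymm hB h)) (by grind)
      refine ⟨q, ?_, p, hp, hpq.symm⟩
      by_contra hqB
      exact hcl q (by grind) p (by grind) hpq.symm
    · obtain ⟨p, hp, q, hq, hpq⟩ := hS.2 B (by grind) hBn (by grind)
      refine ⟨p, hp, q, ?_, hpq⟩
      have : q ∉ A := fun hqA => hcl q hqA p (by grind) hpq.symm
      grind
  have hAlt : A.card < S.card := Finset.card_lt_card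
    (Finset.ssubset_iff_subset_ne.2 ⟨by grind, by grind⟩)
  obtain ⟨c, hc, L, hL, hLn, hcL, hadj, hindep, hor⟩ := ih A.card (by omega) A hAconn a ha
    (Finset.one_lt_card.2 ⟨x, hxA, y, hyA, hxy.ne⟩) rfl
  refine ⟨c, by grind, L, by grind, hLn, hcL, hadj, hindep, Or.inl ?_⟩
  have hsub : insert c L ⊆ A := by grind
  refine ⟨by grind, ?_⟩
  rcases hor with ⟨ha', hc'⟩ | hAe
  · have := hc'.union hrest ha' hb hab
    convert this using 1
    ext z; grind
  · rwa [← hAe]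

/-! ### Partitions into induced stars and their surplus. -/

/-- `G.StarPacking w S k`: the set `S` is partitioned into vertex sets of induced stars of `G`
(possibly single vertices) with total edge weight `k`. -/
inductive StarPacking (G : SimpleGraph V) (w : V → V → ℕ) : Finset V → ℕ → Prop
  | empty : StarPacking G w ∅ 0
  | star {S : Finset V} {k : ℕ} {c : V} {L : Finset V} : StarPacking G w S k → c ∉ S →
      Disjoint S L → c ∉ L → (∀ l ∈ L, G.Adj c l) → (∀ l ∈ L, ∀ l' ∈ L, ¬ G.Adj l l') →
      StarPacking G w (S ∪ insert c L) (k + ∑ l ∈ L, w c l)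

theorem StarPacking.union {S T : Finset V} {k l : ℕ} (hS : G.StarPacking w S k)
    (hT : G.StarPacking w T l) (hd : Disjoint S T) : G.StarPacking w (S ∪ T) (k + l) := by
  induction hT with
  | empty => simpa
  | @star T l c L hT hc hdis hcL hadj hind ih =>
    have h1 : Disjoint S T := hd.mono_right Finset.subset_union_left
    have h2 : Disjoint S (insert c L) := hd.mono_right Finset.subset_union_right
    rw [Finset.disjoint_insert_right] at h2
    rw [← Finset.union_assoc, ← add_assoc]
    exact .star (ih h1) (by simp [hc, h2.1]) (Finset.disjoint_union_left.2 ⟨h2.2, hdis⟩) hcL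
      hadj hind

theorem StarPacking.map {W : Type*} [DecidableEq W] (f : W ↪ V) {S : Finset W} {k : ℕ}
    (h : (G.comap f).StarPacking (fun a b => w (f a) (f b)) S k) :
    G.StarPacking w (S.map f) k := by
  induction h with
  | empty => exact .empty
  | @star S k c L hS hc hdis hcL hadj hind ih =>
    rw [Finset.map_union, Finset.map_insert,
      show ∑ l ∈ L, w (f c) (f l) = ∑ l ∈ L.map f, w (f c) l by simp]
    refine .star ih (by simpa) ((Finset.disjoint_map f).2 hdis) (by simpa) ?_ ?_
    · simpa using hadj
    · simpa using hind

/-- Some partition of `S` into induced stars has weight at least `(|S| + e) / 2`. -/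
def Surplus (G : SimpleGraph V) (w : V → V → ℕ) (S : Finset V) (e : ℤ) : Prop :=
  ∃ k : ℕ, G.StarPacking w S k ∧ (S.card : ℤ) + e ≤ 2 * k

theorem Surplus.mono {S : Finset V} {e e' : ℤ} (h : G.Surplus w S e) (he : e' ≤ e) :
    G.Surplus w S e' := by
  obtain ⟨k, hk, hc⟩ := h
  exact ⟨k, hk, by omega⟩

theorem Surplus.union {S T : Finset V} {e e' : ℤ} (hS : G.Surplus w S e)
    (hT : G.Surplus w T e') (hd : Disjoint S T) : G.Surplus w (S ∪ T) (e + e') := by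
  obtain ⟨k, hk, hc⟩ := hS
  obtain ⟨l, hl, hc'⟩ := hT
  refine ⟨k + l, hk.union hl hd, ?_⟩
  rw [Finset.card_union_of_disjoint hd]
  push_cast
  linarith

theorem surplus_empty : G.Surplus w ∅ 0 := ⟨0, .empty, by simp⟩

theorem surplus_weighted_star {c : V} {L : Finset V} (hcL : c ∉ L) (hadj : ∀ l ∈ L, G.Adj c l)
    (hind : ∀ l ∈ L, ∀ l' ∈ L, ¬ G.Adj l l') :
    G.Surplus w (insert c L) (2 * ∑ l ∈ L, (w c l : ℤ) - L.card - 1) := by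
  refine ⟨0 + ∑ l ∈ L, w c l, ?_, ?_⟩
  · have := StarPacking.star (G := G) (w := w) .empty (by simp : c ∉ ∅) (by simp) hcL hadj hind
    simpa using this
  · rw [Finset.card_insert_of_notMem hcL]
    push_cast
    linarith

/-- A star with `t` leaves has `t + 1` vertices and weight at least `t`. Hence a lone vertex costs
one, an edge is neutral and a cherry gains one. -/
theorem surplus_star (hw : ∀ a b, G.Adj a b → 1 ≤ w a b) {c : V} {L : Finset V} (hcL : c ∉ L)
    (hadj : ∀ l ∈ L, G.Adj c l) (hind : ∀ l ∈ L, ∀ l' ∈ L, ¬ G.Adj l l') :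
    G.Surplus w (insert c L) (L.card - 1) := by
  refine (surplus_weighted_star hcL hadj hind).mono ?_
  have : ∑ l ∈ L, (1 : ℤ) ≤ ∑ l ∈ L, (w c l : ℤ) :=
    Finset.sum_le_sum fun l hl => by exact_mod_cast hw _ _ (hadj l hl)
  simp only [Finset.sum_const, mul_one, nsmul_eq_mul] at this
  linarith

theorem surplus_singleton (v : V) : G.Surplus w {v} (-1) := by
  have := surplus_weighted_star (G := G) (w := w) (c := v) (L := ∅) (by simp) (by simp) (by simp)
  simpa using this

theorem surplus_edge (hw : ∀ a b, G.Adj a b → 1 ≤ w a b) {a b : V} (hab : G.Adj a b) :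
    G.Surplus w {a, b} 0 := by
  have := surplus_star hw (c := a) (L := {b}) (by simpa using hab.ne) (by simpa) (by simp)
  simpa using this

theorem surplus_heavy_edge {a b : V} (hab : G.Adj a b) (h : 2 ≤ w a b) :
    G.Surplus w {a, b} 2 := by
  have := surplus_weighted_star (G := G) (w := w) (c := a) (L := {b}) (by simpa using hab.ne)
    (by simpa) (by simp)
  refine this.mono ?_
  simp only [Finset.sum_singleton, Finset.card_singleton]
  push_cast
  omega

theorem surplus_cherry (hw : ∀ a b, G.Adj a b → 1 ≤ w a b) {c a b : V} (hca : G.Adj c a)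
    (hcb : G.Adj c b) (hne : a ≠ b) (hab : ¬ G.Adj a b) : G.Surplus w {c, a, b} 1 := by
  have := surplus_star hw (c := c) (L := {a, b}) (by simp [hca.ne, hcb.ne]) (by simp [hca, hcb])
    (by
      have hba : ¬ G.Adj b a := fun h => hab h.symm
      simp [hab, hba])
  simpa [Finset.card_pair hne] using this

theorem IsClique.surplus_of_even (hw : ∀ a b, G.Adj a b → 1 ≤ w a b) {K : Finset V}
    (hK : G.IsClique (K : Set V)) (he : Even K.card) : G.Surplus w K 0 := by
  induction hn : K.card using Nat.strong_induction_on generalizing K with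
  | _ n ih =>
  rcases K.eq_empty_or_nonempty with rfl | hne
  · exact surplus_empty
  have h2 : 1 < K.card := by
    have := hne.card_pos
    rcases he with ⟨t, ht⟩
    omega
  obtain ⟨a, ha, b, hb, hab⟩ := Finset.one_lt_card.1 h2
  have hsub : ({a, b} : Finset V) ⊆ K := by grind
  have hcard := Finset.card_sdiff_add_card_eq_card hsub
  rw [Finset.card_pair hab] at hcard
  have h1 := ih (K \ {a, b}).card (by omega) (K := K \ {a, b})
    (hK.subset (by simp)) (by
      rcases he with ⟨t, ht⟩
      exact ⟨t - 1, by omega⟩) rfl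
  have := h1.union (surplus_edge hw (hK ha hb hab)) (Finset.sdiff_disjoint)
  rwa [Finset.sdiff_union_of_subset hsub, add_zero] at this

theorem IsClique.surplus_neg_one (hw : ∀ a b, G.Adj a b → 1 ≤ w a b) {K : Finset V}
    (hK : G.IsClique (K : Set V)) : G.Surplus w K (-1) := by
  rcases Nat.even_or_odd K.card with he | ho
  · exact (hK.surplus_of_even hw he).mono (by norm_num)
  obtain ⟨v, hv⟩ : K.Nonempty := Finset.card_pos.1 ho.pos
  have h1 := IsClique.surplus_of_even hw (K := K.erase v) (hK.subset (by simp)) (by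
    rw [Finset.card_erase_of_mem hv]; exact ho.tsub_odd odd_one)
  have := h1.union (surplus_singleton (G := G) (w := w) v) (by simp)
  rwa [Finset.union_comm, ← Finset.insert_eq, Finset.insert_erase hv, zero_add] at this

/-! ### Odd clique trees as the only obstruction to nonnegative surplus. -/

/-- Sets obtained from a single vertex by repeatedly gluing cliques of odd order along one
vertex. -/
inductive OddCliqueTree (G : SimpleGraph V) : Finset V → Prop
  | single (v : V) : OddCliqueTree G {v}
  | glue {S K : Finset V} {c : V} : OddCliqueTree G S → G.IsClique (K : Set V) → Odd K.card →
      c ∈ S → c ∈ K → (∀ x ∈ S, x ∈ K → x = c) →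
      (∀ x ∈ S, x ≠ c → ∀ y ∈ K, y ≠ c → ¬ G.Adj x y) → OddCliqueTree G (S ∪ K)

/-- Odd clique trees are factor-critical: once `z` is gone, each glued clique has one vertex left to
be covered elsewhere, and its remaining even clique is perfectly matched. -/
theorem OddCliqueTree.surplus_erase (hw : ∀ a b, G.Adj a b → 1 ≤ w a b) {S : Finset V}
    (hS : G.OddCliqueTree S) : ∀ z ∈ S, G.Surplus w (S.erase z) 0 := by
  induction hS with
  | single v =>
    intro z hz
    rw [Finset.mem_singleton.1 hz]
    simpa using surplus_empty
  | @glue S K c hS hK hodd hcS hcK hint hno ih =>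
    have hev : ∀ z ∈ K, G.Surplus w (K.erase z) 0 := fun z hz =>
      IsClique.surplus_of_even hw (hK.subset (by simp)) (by
        rw [Finset.card_erase_of_mem hz]; exact hodd.tsub_odd odd_one)
    intro z hz
    by_cases hzS : z ∈ S
    · have := (ih z hzS).union (hev c hcK) (by
        rw [Finset.disjoint_left]; grind)
      rw [add_zero] at this
      convert this using 1
      ext t; grind
    · have := (ih c hcS).union (hev z (by grind)) (by
        rw [Finset.disjoint_left]; grind)
      rw [add_zero] at this
      convert this using 1
      ext t; grind

theorem OddCliqueTree.surplus_neg_one (hw : ∀ a b, G.Adj a b → 1 ≤ w a b) {S : Finset V}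
    (hS : G.OddCliqueTree S) : G.Surplus w S (-1) := by
  obtain ⟨z, hz⟩ : S.Nonempty := by
    cases hS with
    | single v => simp
    | glue _ _ _ h => exact ⟨_, Finset.mem_union_left _ h⟩
  have := (hS.surplus_erase hw z hz).union (surplus_singleton (G := G) (w := w) z) (by simp)
  rwa [Finset.union_comm, ← Finset.insert_eq, Finset.insert_erase hz, zero_add] at this

theorem IsClique.exists_partner (hw : ∀ a b, G.Adj a b → 1 ≤ w a b) {K : Finset V}
    (hK : G.IsClique (K : Set V)) (hodd : Odd K.card) {z c : V} (hz : z ∈ K) (hc : c ∈ K)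
    (hzc : z ≠ c) : ∃ e ∈ K, e ≠ z ∧ e ≠ c ∧ G.Adj c e ∧ G.Surplus w (K \ {z, c, e}) 0 := by
  have hsub : ({z, c} : Finset V) ⊆ K := by grind
  have hcard := Finset.card_sdiff_add_card_eq_card hsub
  rw [Finset.card_pair hzc] at hcard
  obtain ⟨e, he⟩ : (K \ {z, c}).Nonempty := by
    rw [← Finset.card_pos]
    rcases hodd with ⟨t, ht⟩
    omega
  simp only [Finset.mem_sdiff, Finset.mem_insert, Finset.mem_singleton, not_or] at he
  refine ⟨e, he.1, he.2.1, he.2.2, hK hc he.1 (Ne.symm he.2.2),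
    IsClique.surplus_of_even hw (hK.subset (by simp)) ?_⟩
  have hsub' : ({z, c, e} : Finset V) ⊆ K := by grind
  have hcard' := Finset.card_sdiff_add_card_eq_card hsub'
  rw [Finset.card_eq_three.2 ⟨z, c, e, hzc, Ne.symm he.2.1, Ne.symm he.2.2, rfl⟩] at hcard'
  rcases hodd with ⟨t, ht⟩
  exact ⟨t - 1, by omega⟩

/-- Used at a cut vertex `c`: when `z` is matched outside the tree, `c` and a neighbour `e` can be
set aside without loss, and `e` becomes a leaf of a cherry centred at `c`. -/
theorem OddCliqueTree.exists_partner (hw : ∀ a b, G.Adj a b → 1 ≤ w a b) {S : Finset V}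
    (hS : G.OddCliqueTree S) : ∀ z ∈ S, ∀ c ∈ S, z ≠ c →
      ∃ e ∈ S, e ≠ z ∧ e ≠ c ∧ G.Adj c e ∧ G.Surplus w (S \ {z, c, e}) 0 := by
  induction hS with
  | single v => grind
  | @glue S K c₀ hS hK hodd hcS hcK hint hno ih =>
    have hev : ∀ z ∈ K, G.Surplus w (K.erase z) 0 := fun z hz =>
      IsClique.surplus_of_even hw (hK.subset (by simp)) (by
        rw [Finset.card_erase_of_mem hz]; exact hodd.tsub_odd odd_one)
    intro z hz c hc hzc
    by_cases hzS : z ∈ S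
    · by_cases hcS' : c ∈ S
      · obtain ⟨e, heS, hez, hec, hadj, hsur⟩ := ih z hzS c hcS' hzc
        refine ⟨e, by grind, hez, hec, hadj, ?_⟩
        have := hsur.union (hev c₀ hcK) (by rw [Finset.disjoint_left]; grind)
        rw [add_zero] at this
        convert this using 1
        ext t; grind
      · obtain ⟨e, heK, hez, hec, hadj, hsur⟩ := hK.exists_partner hw hodd hcK
          (by grind : c ∈ K) (by grind)
        refine ⟨e, by grind, by grind, hec, hadj, ?_⟩
        have := (hS.surplus_erase hw z hzS).union hsur (by rw [Finset.disjoint_left]; grind)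
        rw [add_zero] at this
        convert this using 1
        ext t; grind
    · have hzK : z ∈ K := by grind
      by_cases hcK' : c ∈ K
      · obtain ⟨e, heK, hez, hec, hadj, hsur⟩ := hK.exists_partner hw hodd hzK hcK' hzc
        refine ⟨e, by grind, hez, hec, hadj, ?_⟩
        have := (hS.surplus_erase hw c₀ hcS).union hsur (by rw [Finset.disjoint_left]; grind)
        rw [add_zero] at this
        convert this using 1
        ext t; grind
      · obtain ⟨e, heS, hez, hec, hadj, hsur⟩ := ih c₀ hcS c (by grind) (by grind)
        refine ⟨e, by grind, by grind, hec, hadj, ?_⟩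
        have := hsur.union (hev z hzK) (by rw [Finset.disjoint_left]; grind)
        rw [add_zero] at this
        convert this using 1
        ext t; grind

/-- A heavy edge alone has surplus two. This outweighs the loss of one in the rest of its clique,
and everything else is matched. -/
theorem OddCliqueTree.surplus_of_heavy (hw : ∀ a b, G.Adj a b → 1 ≤ w a b) {S : Finset V}
    (hS : G.OddCliqueTree S) :
    ∀ x ∈ S, ∀ y ∈ S, G.Adj x y → 2 ≤ w x y → G.Surplus w S 0 := by
  induction hS with
  | single v =>
    intro x hx y hy hxy
    rw [Finset.mem_singleton.1 hx, Finset.mem_singleton.1 hy] at hxy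
    exact absurd hxy (G.loopless.irrefl v)
  | @glue S K c hS hK hodd hcS hcK hint hno ih =>
    intro x hx y hy hxy h2
    by_cases hS2 : x ∈ S ∧ y ∈ S
    · have := (ih x hS2.1 y hS2.2 hxy h2).union
        (IsClique.surplus_of_even hw (K := K.erase c) (hK.subset (by simp)) (by
          rw [Finset.card_erase_of_mem hcK]; exact hodd.tsub_odd odd_one))
        (by rw [Finset.disjoint_left]; grind)
      rw [add_zero] at this
      convert this using 1
      ext t; grind
    by_cases hK2 : x ∈ K ∧ y ∈ K
    · have h1 := (surplus_heavy_edge hxy h2).union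
        (IsClique.surplus_neg_one hw (K := K \ {x, y}) (hK.subset (by simp)))
        Finset.disjoint_sdiff
      have := (h1.union (hS.surplus_erase hw c hcS) (by rw [Finset.disjoint_left]; grind)).mono
        (by norm_num : (0 : ℤ) ≤ 2 + -1 + 0)
      convert this using 1
      ext t; grind
    exfalso
    have hx' := Finset.mem_union.1 hx
    have hy' := Finset.mem_union.1 hy
    by_cases hxS : x ∈ S
    · exact hno x hxS (by grind) y (by grind) (by grind) hxy
    · exact hno y (by grind) (by grind) x (by grind) (by grind) hxy.symm

/-- Adjacent twins whose neighbourhood in the tree is one vertex or a whole clique extend the tree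
by a triangle or enlarge that clique. Any other neighbourhood leaves room for a cherry that repairs
the surplus. -/
theorem OddCliqueTree.add_twins (hw : ∀ a b, G.Adj a b → 1 ≤ w a b) {S : Finset V}
    (hS : G.OddCliqueTree S) {u v : V} (huv : G.Adj u v) (hu : u ∉ S) (hv : v ∉ S)
    (htwin : ∀ z ∈ S, G.Adj u z ↔ G.Adj v z) (hnb : ∃ z ∈ S, G.Adj u z)
    (hsur : ¬ G.Surplus w (S ∪ {u, v}) 0) : G.OddCliqueTree (S ∪ {u, v}) := by
  have huv' := huv.ne
  have tri : ∀ z, G.Adj u z → G.Adj v z → G.IsClique (({z, u, v} : Finset V) : Set V) := by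
    intro z h1 h2
    rw [Finset.coe_insert, Finset.coe_pair]
    simp only [isClique_insert, Set.mem_insert_iff, Set.mem_singleton_iff]
    refine ⟨by simp [huv], ?_⟩
    rintro b (rfl | rfl) _
    exacts [h1.symm, h2.symm]
  have tri_odd : ∀ z, G.Adj u z → G.Adj v z → Odd ({z, u, v} : Finset V).card := by
    intro z h1 h2
    rw [Finset.card_eq_three.2 ⟨z, u, v, h1.ne', h2.ne', huv', rfl⟩]
    decide
  induction hS with
  | single z =>
    obtain ⟨z', hz', hadj⟩ := hnb
    rw [Finset.mem_singleton] at hz'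
    subst hz'
    have h2 := (htwin z' (by simp)).1 hadj
    have := OddCliqueTree.glue (.single z') (tri z' hadj h2) (tri_odd z' hadj h2) (by simp)
      (by simp : z' ∈ _) (by grind) (by grind)
    convert this using 1
    ext t; grind
  | @glue S K c hS hK hodd hcS hcK hint hno ih =>
    have hev : ∀ z ∈ K, G.Surplus w (K.erase z) 0 := fun z hz =>
      IsClique.surplus_of_even hw (hK.subset (by simp)) (by
        rw [Finset.card_erase_of_mem hz]; exact hodd.tsub_odd odd_one)
    by_cases hA : ∃ z₁ ∈ K, z₁ ≠ c ∧ G.Adj u z₁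
    · obtain ⟨z₁, hz₁, hz₁c, hadj₁⟩ := hA
      by_cases hB : ∃ z₂ ∈ S, z₂ ≠ c ∧ G.Adj u z₂
      -- The twins have neighbours on both sides of `c`: match `u` with `z₁` and `v` with `z₂`. The
      -- cherry `e₁ c e₂` is induced because no edge crosses `c`.
      · exfalso
        apply hsur
        obtain ⟨z₂, hz₂, hz₂c, hadj₂⟩ := hB
        obtain ⟨e₁, he₁, hne₁, hnc₁, had₁, hs₁⟩ := hK.exists_partner hw hodd hz₁ hcK hz₁c
        obtain ⟨e₂, he₂, hne₂, hnc₂, had₂, hs₂⟩ := hS.exists_partner hw z₂ hz₂ c hcS hz₂c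
        have h1 := surplus_edge hw hadj₁
        have h2 := surplus_edge hw ((htwin z₂ (by grind)).1 hadj₂)
        have h3 := surplus_cherry hw had₁ had₂ (by grind)
          (fun h => hno e₂ he₂ hnc₂ e₁ he₁ hnc₁ h.symm)
        have := (((h1.union h2 (by rw [Finset.disjoint_left]; grind)).union h3
          (by rw [Finset.disjoint_left]; grind)).union (hs₁.union hs₂
          (by rw [Finset.disjoint_left]; grind)) (by rw [Finset.disjoint_left]; grind)).mono
          (by norm_num : (0 : ℤ) ≤ 0 + 0 + 1 + (0 + 0))
        convert this using 1
        clear * - hz₁ hz₂ hcS hcK he₁ he₂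
        ext t
        simp only [Finset.mem_union, Finset.mem_sdiff, Finset.mem_insert, Finset.mem_singleton]
        grind
      · push Not at hB
        -- All neighbours now lie in `K`. There may be exactly one (glue a triangle), all of `K`
        -- (enlarge the clique), or at least two with one vertex missed.
        by_cases hone : ∀ z ∈ K, G.Adj u z → z = z₁
        · have h2 := (htwin z₁ (by grind)).1 hadj₁
          have := OddCliqueTree.glue (.glue hS hK hodd hcS hcK hint hno) (tri z₁ hadj₁ h2)
            (tri_odd z₁ hadj₁ h2) (by grind) (by simp : z₁ ∈ _) (by grind) (by
              intro x hx hxz y hy hyz hxy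
              have hux : G.Adj u x := by
                simp only [Finset.mem_insert, Finset.mem_singleton] at hy
                rcases hy with rfl | rfl | rfl
                exacts [absurd rfl hyz, hxy.symm, (htwin x hx).2 hxy.symm]
              rcases Finset.mem_union.1 hx with hx | hx
              · by_cases hxc : x = c
                · exact hxz (hone x (hxc ▸ hcK) hux)
                · exact hB x hx hxc hux
              · exact hxz (hone x hx hux))
          convert this using 1
          ext t; grind
        push Not at hone
        obtain ⟨z₂, hz₂, hadj₂, hne⟩ := hone
        by_cases hall : ∀ z ∈ K, G.Adj u z
        · have hcl : G.IsClique ((K ∪ {u, v} : Finset V) : Set V) := by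
            intro a ha b hb hab
            simp only [Finset.coe_union, Set.mem_union, Finset.mem_coe, Finset.mem_insert,
              Finset.mem_singleton] at ha hb
            have hvz : ∀ z ∈ K, G.Adj v z := fun z hz => (htwin z (by grind)).1 (hall z hz)
            rcases ha with ha | rfl | rfl <;> rcases hb with hb | rfl | rfl
            · exact hK ha hb hab
            · exact (hall a ha).symm
            · exact (hvz a ha).symm
            · exact hall b hb
            · exact absurd rfl hab
            · exact huv
            · exact hvz b hb
            · exact huv.symm
            · exact absurd rfl hab
          have hd : Disjoint K {u, v} := by rw [Finset.disjoint_left]; grind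
          have := OddCliqueTree.glue hS hcl (by
            rw [Finset.card_union_of_disjoint hd, Finset.card_pair huv']
            exact hodd.add_even even_two) hcS (by grind) (by grind) (by
              intro x hx hxc y hy hyc hxy
              rcases Finset.mem_union.1 hy with hy | hy
              · exact hno x hx hxc y hy hyc hxy
              · have : G.Adj u x := by
                  rcases Finset.mem_insert.1 hy with rfl | hy
                  · exact hxy.symm
                  · rw [Finset.mem_singleton] at hy
                    subst hy
                    exact (htwin x (by grind)).2 hxy.symm
                exact hB x hx hxc this)
          rwa [Finset.union_assoc]
        · exfalso
          apply hsur
          push Not at hall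
          obtain ⟨z, hz, hnadj⟩ := hall
          -- The cherry centred at `z₁` with leaves `u` and the missed vertex `z` gains one, `v z₂`
          -- is an edge, and the rest of `K` is even.
          have h1 := surplus_cherry hw hadj₁.symm (hK hz₁ hz (by grind)) (by grind) hnadj
          have h2 := surplus_edge hw ((htwin z₂ (by grind)).1 hadj₂)
          have h3 : G.Surplus w (K \ {z₁, z₂, z}) 0 := by
            refine IsClique.surplus_of_even hw (hK.subset (by simp)) ?_
            have hsub' : ({z₁, z₂, z} : Finset V) ⊆ K := by simp [Finset.insert_subset_iff, *]
            have hcard' := Finset.card_sdiff_add_card_eq_card hsub'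
            rw [Finset.card_eq_three.2 ⟨z₁, z₂, z, by grind, by grind, by grind, rfl⟩] at hcard'
            rcases hodd with ⟨t, ht⟩
            exact ⟨t - 1, by omega⟩
          have hne₂ : z ≠ z₁ ∧ z ≠ z₂ := by
            constructor <;> rintro rfl <;> exact hnadj ‹_›
          simp only [Finset.mem_union, not_or] at hu hv
          have d1 : Disjoint ({z₁, u, z} : Finset V) {v, z₂} := by
            clear * - hv huv' hz₁ hz₂ hne hne₂ hz hu
            simp only [Finset.disjoint_left, Finset.mem_insert, Finset.mem_singleton]
            grind
          have d2 : Disjoint ({z₁, u, z} ∪ {v, z₂}) (K \ {z₁, z₂, z}) := by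
            clear * - hv hu
            simp only [Finset.disjoint_left, Finset.mem_insert, Finset.mem_singleton,
              Finset.mem_union, Finset.mem_sdiff]
            grind
          have d3 : Disjoint ({z₁, u, z} ∪ {v, z₂} ∪ K \ {z₁, z₂, z}) (S.erase c) := by
            clear * - hv hu hz₁ hz₂ hz hint
            simp only [Finset.disjoint_left, Finset.mem_insert, Finset.mem_singleton,
              Finset.mem_union, Finset.mem_sdiff, Finset.mem_erase]
            grind
          have := (((h1.union h2 d1).union h3 d2).union (hS.surplus_erase hw c hcS) d3).mono
            (by norm_num : (0 : ℤ) ≤ 1 + 0 + 0 + 0)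
          convert this using 1
          clear * - hz₁ hz₂ hz hcK
          ext t
          simp only [Finset.mem_union, Finset.mem_sdiff, Finset.mem_insert, Finset.mem_singleton,
            Finset.mem_erase]
          grind
    · push Not at hA
      -- Nothing in `K - c` sees the twins, so they are added to the smaller tree and `K` is glued
      -- back afterwards.
      have hsub : G.OddCliqueTree (S ∪ {u, v}) := by
        refine ih (by grind) (by grind) (fun z hz => htwin z (by grind)) ?_ ?_
        · obtain ⟨z, hz, hadj⟩ := hnb
          refine ⟨z, ?_, hadj⟩
          by_contra h
          exact hA z (by grind) (by grind) hadj
        · intro h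
          apply hsur
          have := h.union (hev c hcK) (by rw [Finset.disjoint_left]; grind)
          rw [add_zero] at this
          convert this using 1
          ext t; grind
      have := OddCliqueTree.glue hsub hK hodd (by grind) hcK (by grind) (by
        intro x hx hxc y hy hyc hxy
        rcases Finset.mem_union.1 hx with hx | hx
        · exact hno x hx hxc y hy hyc hxy
        · have : G.Adj u y := by
            rcases Finset.mem_insert.1 hx with rfl | hx
            · exact hxy
            · rw [Finset.mem_singleton] at hx
              subst hx
              exact (htwin y (by grind)).2 hxy
          exact hA y hy hyc this)
      convert this using 1
      ext t; grind

/-- If exactly one end of the edge saw `z`, the path through `u`, `v`, `z` would be a cherry and the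
tree minus `z` neutral. So the ends are twins. -/
theorem OddCliqueTree.add_edge (hw : ∀ a b, G.Adj a b → 1 ≤ w a b) {S : Finset V}
    (hS : G.OddCliqueTree S) {u v : V} (huv : G.Adj u v) (hu : u ∉ S) (hv : v ∉ S)
    (hnb : ∃ z ∈ S, G.Adj u z ∨ G.Adj v z)
    (hsur : ¬ G.Surplus w (S ∪ {u, v}) 0) : G.OddCliqueTree (S ∪ {u, v}) := by
  have key : ∀ a b : V, G.Adj a b → a ∉ S → b ∉ S → ¬ G.Surplus w (S ∪ {a, b}) 0 →
      ∀ z ∈ S, G.Adj a z → G.Adj b z := by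
    intro a b hab ha hb hs z hz haz
    by_contra hbz
    apply hs
    have := ((surplus_cherry hw hab haz (by grind) hbz).union (hS.surplus_erase hw z hz)
      (by rw [Finset.disjoint_left]; grind)).mono (by norm_num : (0 : ℤ) ≤ 1 + 0)
    convert this using 1
    ext t; grind
  have htw : ∀ z ∈ S, G.Adj u z ↔ G.Adj v z := fun z hz =>
    ⟨key u v huv hu hv hsur z hz, key v u huv.symm hv hu (by rwa [Finset.pair_comm]) z hz⟩
  refine hS.add_twins hw huv hu hv htw ?_ hsur
  obtain ⟨z, hz, h⟩ := hnb
  exact ⟨z, hz, h.elim id (htw z hz).2⟩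

/-- Peel off a terminal star and induct. An odd clique tree loses only one, which a star with two
leaves regains, so only a single edge attached to such a tree needs work. -/
theorem CutConnected.surplus_or_oddCliqueTree (hw : ∀ a b, G.Adj a b → 1 ≤ w a b)
    {S : Finset V} (hS : G.CutConnected S) : G.Surplus w S 0 ∨ G.OddCliqueTree S := by
  induction hn : S.card using Nat.strong_induction_on generalizing S with
  | _ n ih =>
  obtain ⟨r, hr⟩ := hS.1
  by_cases h1 : S.card = 1
  · obtain ⟨v, rfl⟩ := Finset.card_eq_one.1 h1
    exact Or.inr (.single v)
  have h2 : 2 ≤ S.card := by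
    have := hS.1.card_pos
    omega
  obtain ⟨c, hc, L, hL, hLn, hcL, hadj, hind, hor⟩ := exists_terminal_star S hS r hr h2
  have hstar := surplus_star hw hcL hadj hind
  have hLpos := hLn.card_pos
  rcases hor with ⟨hr', hconn⟩ | hSe
  swap
  · left
    rw [hSe]
    exact hstar.mono (by omega)
  have hsub : insert c L ⊆ S := by grind
  have hSeq : (S \ insert c L) ∪ insert c L = S := Finset.sdiff_union_of_subset hsub
  have hlt : (S \ insert c L).card < S.card := Finset.card_lt_card
    (Finset.ssubset_iff_subset_ne.2 ⟨Finset.sdiff_subset, by grind⟩)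
  have hdis : Disjoint (S \ insert c L) (insert c L) := Finset.sdiff_disjoint
  rcases ih _ (by omega) hconn rfl with h | h
  · left
    rw [← hSeq]
    exact (h.union hstar hdis).mono (by omega)
  by_cases hL2 : 2 ≤ L.card
  · left
    rw [← hSeq]
    exact ((h.surplus_neg_one hw).union hstar hdis).mono (by omega)
  obtain ⟨l, rfl⟩ := Finset.card_eq_one.1 (by omega : L.card = 1)
  by_cases hs : G.Surplus w S 0
  · exact Or.inl hs
  right
  rw [← hSeq]
  refine h.add_edge hw (hadj l (by simp)) (by grind) (by grind) ?_ (by rwa [hSeq])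
  obtain ⟨a, ha, b, hb, hab⟩ := hS.2 (S \ insert c {l}) Finset.sdiff_subset ⟨r, hr'⟩ (by grind)
  refine ⟨a, ha, ?_⟩
  have : b = c ∨ b = l := by grind
  rcases this with rfl | rfl
  exacts [Or.inl hab.symm, Or.inr hab.symm]

end SimpleGraph

/-! ### Odd clique trees are tight; packings over all components. -/

namespace SimpleGraph

variable {V : Type*} {G : SimpleGraph V}

theorem Preconnected.exists_adj_boundary (h : G.Preconnected) {A : Set V} {a b : V} (ha : a ∈ A)
    (hb : b ∉ A) : ∃ x ∈ A, ∃ y ∉ A, G.Adj x y := by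
  obtain ⟨p⟩ := h a b
  obtain ⟨d, -, h1, h2⟩ := p.exists_boundary_dart A ha hb
  exact ⟨_, h1, _, h2, d.adj⟩

theorem Connected.cutConnected_univ [Fintype V] [DecidableEq V] (h : G.Connected) :
    G.CutConnected Finset.univ := by
  obtain ⟨v⟩ := h.nonempty
  refine ⟨⟨v, by simp⟩, fun A _ hne hA => ?_⟩
  obtain ⟨a, ha⟩ := hne
  obtain ⟨b, hb⟩ : ∃ b, b ∉ A := by
    by_contra hcon
    push Not at hcon
    exact hA (Finset.eq_univ_iff_forall.2 hcon)
  obtain ⟨x, hx, y, hy, hxy⟩ := h.preconnected.exists_adj_boundary (A := (A : Set V))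
    (by exact_mod_cast ha) (by exact_mod_cast hb)
  exact ⟨x, by simpa using hx, y, by simpa using hy, hxy⟩

theorem IsClique.preconnected_induce {K : Set V} (hK : G.IsClique K) :
    (G.induce K).Preconnected := by
  intro x y
  by_cases h : x = y
  · exact h ▸ Reachable.refl _
  · exact Adj.reachable (G := G.induce K) (hK x.2 y.2 fun h' => h (Subtype.ext h'))

theorem IsClique.nonseparableOn {K : Set V} (hK : G.IsClique K) (hne : K.Nonempty) :
    G.NonseparableOn K :=
  ⟨haveI := hne.to_subtype; ⟨hK.preconnected_induce⟩,
    fun _ _ => (hK.subset Set.sdiff_subset).preconnected_induce⟩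

/-- A nonseparable set cannot have vertices on both sides of a gluing vertex `c`, since deleting `c`
would disconnect it. -/
theorem OddCliqueTree.exists_odd_clique [DecidableEq V] {S : Finset V} (hS : G.OddCliqueTree S)
    {B : Set V} (hBS : B ⊆ S) (hB : G.NonseparableOn B) :
    ∃ K : Finset V, B ⊆ K ∧ G.IsClique (K : Set V) ∧ Odd K.card := by
  induction hS with
  | single v => exact ⟨{v}, hBS, by simp, by simp⟩
  | @glue S K c hS hK hodd hcS hcK hint hno ih =>
    by_cases h1 : B ⊆ S
    · exact ih h1
    by_cases h2 : B ⊆ K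
    · exact ⟨K, h2, hK, hodd⟩
    exfalso
    obtain ⟨y, hyB, hyS⟩ := Set.not_subset.1 h1
    obtain ⟨x, hxB, hxK⟩ := Set.not_subset.1 h2
    rw [Finset.mem_coe] at hyS hxK
    have hxc : x ≠ c := by rintro rfl; exact hxK hcK
    have hyc : y ≠ c := by rintro rfl; exact hyS hcS
    have hpre : (G.induce (B \ {c})).Preconnected := by
      by_cases hcB : c ∈ B
      · exact hB.2 c hcB
      · rw [Set.sdiff_singleton_eq_self hcB]
        exact hB.1.preconnected
    obtain ⟨p, hp, q, hq, hpq⟩ := hpre.exists_adj_boundary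
      (A := {z : (B \ {c} : Set V) | (z : V) ∈ S}) (a := ⟨x, hxB, hxc⟩) (b := ⟨y, hyB, hyc⟩)
      (by
        have := hBS hxB
        simp only [Finset.coe_union, Set.mem_union, Finset.mem_coe] at this
        exact this.resolve_right hxK) hyS
    have hqK : (q : V) ∈ K := by
      have := hBS q.2.1
      simp only [Finset.coe_union, Set.mem_union, Finset.mem_coe] at this
      exact this.resolve_left hq
    exact hno p hp p.2.2 q hqK q.2.2 hpq

theorem OddCliqueTree.isTight [Fintype V] [DecidableEq V] (h : G.OddCliqueTree Finset.univ)
    (hc : G.Connected) : G.IsTight := by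
  refine ⟨hc, fun B hB => ?_⟩
  obtain ⟨K, hBK, hK, hodd⟩ := h.exists_odd_clique (by simp) hB.prop
  have hBe : B = K := Set.Subset.antisymm hBK
    (hB.2 (hK.nonseparableOn (by simpa using Finset.card_pos.1 hodd.pos)) hBK)
  rw [hBe, Set.ncard_coe_finset]
  exact ⟨hK, hodd⟩

theorem Connected.exists_starPacking [Fintype V] [DecidableEq V] {w : V → V → ℕ}
    (hc : G.Connected) (hw : ∀ a b, G.Adj a b → 1 ≤ w a b) :
    ∃ k, G.StarPacking w Finset.univ k ∧ Fintype.card V ≤ 2 * k + 1 ∧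
      (¬ (G.IsTight ∧ ∀ a b, G.Adj a b → w a b ≤ 1) → Fintype.card V ≤ 2 * k) := by
  have key : G.Surplus w Finset.univ 0 ∨
      G.OddCliqueTree Finset.univ ∧ ∀ a b, G.Adj a b → w a b ≤ 1 := by
    rcases hc.cutConnected_univ.surplus_or_oddCliqueTree hw with h | h
    · exact Or.inl h
    by_cases h1 : ∀ a b, G.Adj a b → w a b ≤ 1
    · exact Or.inr ⟨h, h1⟩
    push Not at h1
    obtain ⟨a, b, hab, h2⟩ := h1
    exact Or.inl (h.surplus_of_heavy hw a (by simp) b (by simp) hab h2)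
  rcases key with ⟨k, hk, hcard⟩ | ⟨h, h1⟩
  · rw [Finset.card_univ] at hcard
    exact ⟨k, hk, by omega, fun _ => by omega⟩
  · obtain ⟨k, hk, hcard⟩ := h.surplus_neg_one hw
    rw [Finset.card_univ] at hcard
    exact ⟨k, hk, by omega, fun hn => absurd ⟨h.isTight hc, h1⟩ hn⟩

theorem StarPacking.biUnion [DecidableEq V] {w : V → V → ℕ} {ι : Type*} [DecidableEq ι]
    (s : Finset ι) (f : ι → Finset V) (k : ι → ℕ) (h : ∀ i ∈ s, G.StarPacking w (f i) (k i))
    (hd : (s : Set ι).PairwiseDisjoint f) : G.StarPacking w (s.biUnion f) (∑ i ∈ s, k i) := by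
  induction s using Finset.induction_on with
  | empty => exact .empty
  | insert i s hi ih =>
    rw [Finset.biUnion_insert, Finset.sum_insert hi]
    refine (h i (by simp)).union (ih (fun j hj => h j (by simp [hj])) (hd.subset (by simp))) ?_
    rw [Finset.disjoint_biUnion_right]
    exact fun j hj => hd (by simp) (by simp [hj]) fun h => hi (h ▸ hj)

theorem exists_starPacking [Fintype V] [DecidableEq V] (G : SimpleGraph V) {w : V → V → ℕ}
    (hw : ∀ a b, G.Adj a b → 1 ≤ w a b) :
    ∃ k, G.StarPacking w Finset.univ k ∧ Fintype.card V ≤ 2 * k +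
      {T : G.ConnectedComponent | (G.induce T.supp).IsTight ∧
        ∀ a ∈ T.supp, ∀ b ∈ T.supp, G.Adj a b → w a b ≤ 1}.ncard := by
  classical
  have hcomp : ∀ T : G.ConnectedComponent, ∃ k, G.StarPacking w T.supp.toFinset k ∧
      T.supp.toFinset.card ≤ 2 * k + if (G.induce T.supp).IsTight ∧
        ∀ a ∈ T.supp, ∀ b ∈ T.supp, G.Adj a b → w a b ≤ 1 then 1 else 0 := by
    intro T
    obtain ⟨k, hk, h1, h2⟩ := Connected.exists_starPacking (G := G.induce T.supp)
      (w := fun a b => w a b) T.connected_toSimpleGraph (fun a b hab => hw _ _ hab)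
    have hmap := StarPacking.map (G := G) (w := w) (Function.Embedding.subtype _) hk
    refine ⟨k, ?_, ?_⟩
    · convert hmap using 1
      ext; simp
    · rw [Set.toFinset_card]
      split_ifs with hif
      · exact h1
      · refine h2 fun h => hif ⟨h.1, fun a ha b hb hab => h.2 ⟨a, ha⟩ ⟨b, hb⟩ hab⟩
  choose k hk hcard using hcomp
  have hd : ((Finset.univ : Finset G.ConnectedComponent) : Set G.ConnectedComponent).PairwiseDisjoint
      fun T => T.supp.toFinset := by
    intro S _ T _ hST
    rw [Function.onFun, Set.disjoint_toFinset]
    exact pairwise_disjoint_supp_connectedComponent _ hST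
  have huniv : (Finset.univ : Finset G.ConnectedComponent).biUnion
      (fun T => T.supp.toFinset) = Finset.univ := by
    ext v
    simp
  refine ⟨∑ T, k T, ?_, ?_⟩
  · rw [← huniv]
    exact StarPacking.biUnion _ _ _ (fun T _ => hk T) hd
  · rw [← Finset.card_univ, ← huniv, Finset.card_biUnion hd, Finset.mul_sum,
      Set.ncard_eq_toFinset_card', Set.toFinset_ofPred, Finset.card_filter,
      ← Finset.sum_add_distrib]
    exact Finset.sum_le_sum fun T _ => hcard T

end SimpleGraph

/-! ### Greedy sign choices and grouped signings. -/

theorem exists_signs_quadratic {ι : Type*} [DecidableEq ι] (s : Finset ι) (c : ι → ι → ℝ)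
    (b : ι → ℝ) : ∃ σ : ι → ℝ, (∀ i, σ i = 1 ∨ σ i = -1) ∧
      ∑ i ∈ s, ∑ j ∈ s, c i j * (σ i * σ j) + ∑ i ∈ s, b i * σ i ≤ ∑ i ∈ s, c i i := by
  induction s using Finset.induction_on with
  | empty => exact ⟨fun _ => 1, by simp, by simp⟩
  | insert i s hi ih =>
    -- The bound is the mean over uniform random signs. Besides the diagonal term, the new index
    -- contributes its sign times `R`, so one of the two signs does not exceed the mean.
    obtain ⟨σ, hσ, hle⟩ := ih
    set R := ∑ j ∈ s, c i j * σ j + ∑ j ∈ s, c j i * σ j + b i with hR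
    obtain ⟨t, ht, htR⟩ : ∃ t : ℝ, (t = 1 ∨ t = -1) ∧ t * R ≤ 0 := by
      rcases le_total R 0 with h | h
      exacts [⟨1, by simp, by simpa⟩, ⟨-1, by simp, by simpa⟩]
    refine ⟨Function.update σ i t, fun j => ?_, ?_⟩
    · by_cases h : j = i
      · subst h; simpa
      · simpa [h] using hσ j
    have hne : ∀ j ∈ s, Function.update σ i t j = σ j := fun j hj =>
      Function.update_of_ne (by rintro rfl; exact hi hj) _ _
    have hcongr : ∀ f : ι → ℝ → ℝ, ∑ j ∈ s, f j (Function.update σ i t j) = ∑ j ∈ s, f j (σ j) :=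
      fun f => Finset.sum_congr rfl fun j hj => by rw [hne j hj]
    simp only [Finset.sum_insert hi, Function.update_self, Finset.sum_add_distrib]
    rw [hcongr fun j x => c i j * (t * x), hcongr fun j x => c j i * (x * t),
      hcongr fun j x => b j * x,
      Finset.sum_congr rfl fun j hj => (show
        ∑ l ∈ s, c j l * (Function.update σ i t j * Function.update σ i t l) =
          ∑ l ∈ s, c j l * (σ j * σ l) by
        rw [hcongr fun l x => c j l * (Function.update σ i t j * x), hne j hj])]
    have e1 : ∑ j ∈ s, c i j * (t * σ j) = t * ∑ j ∈ s, c i j * σ j := by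
      rw [Finset.mul_sum]; exact Finset.sum_congr rfl fun _ _ => by ring
    have e2 : ∑ j ∈ s, c j i * (σ j * t) = t * ∑ j ∈ s, c j i * σ j := by
      rw [Finset.mul_sum]; exact Finset.sum_congr rfl fun _ _ => by ring
    have e3 : t * t = 1 := by rcases ht with rfl | rfl <;> norm_num
    rw [e1, e2, e3]
    rw [hR] at htR
    nlinarith

/-- The set `S` is partitioned by `g` into groups of weight at most `M` and carries signs `p`, so
that the arcs inside groups contribute at most `q` to the quadratic form of `a`. -/
def GroupedSigning {V : Type*} [DecidableEq V] (a : V → V → ℝ) (wt : V → ℝ) (M : ℝ)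
    (S : Finset V) (q : ℝ) : Prop :=
  ∃ (g : V → V) (p : V → ℝ), (∀ v ∈ S, g v ∈ S) ∧ (∀ v, p v = 1 ∨ p v = -1) ∧
    (∀ i, ∑ v ∈ S with g v = i, wt v ≤ M) ∧
    ∑ u ∈ S, ∑ v ∈ S, (if g u = g v then a u v * (p u * p v) else 0) ≤ q

namespace GroupedSigning

variable {V : Type*} [DecidableEq V] {a : V → V → ℝ} {wt : V → ℝ} {M : ℝ}

theorem mono {S : Finset V} {q q' : ℝ} (h : GroupedSigning a wt M S q) (hq : q ≤ q') :
    GroupedSigning a wt M S q' := by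
  obtain ⟨g, p, h1, h2, h3, h4⟩ := h
  exact ⟨g, p, h1, h2, h3, h4.trans hq⟩

theorem union {S T : Finset V} {q r : ℝ} (hS : GroupedSigning a wt M S q)
    (hT : GroupedSigning a wt M T r) (hd : Disjoint S T) :
    GroupedSigning a wt M (S ∪ T) (q + r) := by
  obtain ⟨g, p, hg, hp, hw, hq⟩ := hS
  obtain ⟨g', p', hg', hp', hw', hq'⟩ := hT
  have hTS : ∀ v ∈ T, v ∉ S := fun v hv hvS => Finset.disjoint_left.1 hd hvS hv
  -- Group labels are vertices of the set itself, so groups of disjoint sets never merge.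
  refine ⟨fun v => if v ∈ S then g v else g' v, fun v => if v ∈ S then p v else p' v, ?_, ?_, ?_,
    ?_⟩
  · intro v hv
    by_cases hvS : v ∈ S
    · simp [hvS, hg v hvS]
    · simp [hvS, hg' v ((Finset.mem_union.1 hv).resolve_left hvS)]
  · intro v
    by_cases hvS : v ∈ S
    · simpa [hvS] using hp v
    · simpa [hvS] using hp' v
  · intro i
    rw [Finset.filter_union, Finset.sum_union (Finset.disjoint_filter_filter hd)]
    have e1 : S.filter (fun v => (if v ∈ S then g v else g' v) = i) = S.filter (g · = i) :=
      Finset.filter_congr fun v hv => by simp [hv]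
    have e2 : T.filter (fun v => (if v ∈ S then g v else g' v) = i) = T.filter (g' · = i) :=
      Finset.filter_congr fun v hv => by simp [hTS v hv]
    rw [e1, e2]
    by_cases hi : i ∈ S
    · have : T.filter (g' · = i) = ∅ := Finset.filter_eq_empty_iff.2 fun v hv h =>
        hTS i (h ▸ hg' v hv) hi
      rw [this, Finset.sum_empty, add_zero]
      exact hw i
    · have : S.filter (g · = i) = ∅ := Finset.filter_eq_empty_iff.2 fun v hv h =>
        hi (h ▸ hg v hv)
      rw [this, Finset.sum_empty, zero_add]
      exact hw' i
  · rw [Finset.sum_union hd]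
    refine add_le_add (le_trans (le_of_eq ?_) hq) (le_trans (le_of_eq ?_) hq')
    · refine Finset.sum_congr rfl fun u hu => ?_
      rw [Finset.sum_union hd]
      have : ∑ v ∈ T, (if (if u ∈ S then g u else g' u) = (if v ∈ S then g v else g' v) then
          a u v * ((if u ∈ S then p u else p' u) * (if v ∈ S then p v else p' v)) else 0) = 0 :=
        Finset.sum_eq_zero fun v hv => by
          rw [if_neg]
          rw [if_pos hu, if_neg (hTS v hv)]
          exact fun h => hTS _ (hg' v hv) (h ▸ hg u hu)
      rw [this, add_zero]
      exact Finset.sum_congr rfl fun v hv => by simp [hu, hv]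
    · refine Finset.sum_congr rfl fun u hu => ?_
      rw [Finset.sum_union hd]
      have : ∑ v ∈ S, (if (if u ∈ S then g u else g' u) = (if v ∈ S then g v else g' v) then
          a u v * ((if u ∈ S then p u else p' u) * (if v ∈ S then p v else p' v)) else 0) = 0 :=
        Finset.sum_eq_zero fun v hv => by
          rw [if_neg]
          rw [if_pos hv, if_neg (hTS u hu)]
          exact fun h => hTS _ (hg' u hu) (h ▸ hg v hv)
      rw [this, zero_add]
      exact Finset.sum_congr rfl fun v hv => by simp [hTS u hu, hTS v hv]

theorem singletons (hM : 0 ≤ M) (ha : ∀ v, a v v = 0) {S : Finset V} (hw : ∀ v ∈ S, wt v ≤ M) :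
    GroupedSigning a wt M S 0 := by
  refine ⟨id, fun _ => 1, fun v hv => hv, fun _ => Or.inl rfl, fun i => ?_, ?_⟩
  · simp only [id, Finset.filter_eq']
    split_ifs with h
    · simpa using hw i h
    · simpa using hM
  · refine le_of_eq (Finset.sum_eq_zero fun u _ => Finset.sum_eq_zero fun v _ => ?_)
    split_ifs with h
    · simp only [id] at h
      rw [h, ha, zero_mul]
    · rfl

theorem star (hM : 0 ≤ M) (ha : ∀ v, a v v = 0) {c : V} {L : Finset V} (hcL : c ∉ L)
    (hL : ∀ l ∈ L, ∀ l' ∈ L, a l l' = 0) (hw : wt c + ∑ l ∈ L, wt l ≤ M) :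
    GroupedSigning a wt M (insert c L) (-∑ l ∈ L, (a c l + a l c)) := by
  refine ⟨fun _ => c, fun v => if v = c then 1 else -1, fun _ _ => by simp,
    fun v => by by_cases h : v = c <;> simp [h], fun i => ?_, ?_⟩
  · by_cases h : c = i
    · simpa [h, h ▸ hcL] using h ▸ hw
    · simpa [h] using hM
  · have hne : ∀ l ∈ L, l ≠ c := fun l hl h => hcL (h ▸ hl)
    simp only [if_true, Finset.sum_insert hcL, ha, zero_mul, zero_add]
    have e1 : ∑ l ∈ L, a c l * (1 * if l = c then 1 else -1) = -∑ l ∈ L, a c l := by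
      rw [← Finset.sum_neg_distrib]
      exact Finset.sum_congr rfl fun l hl => by rw [if_neg (hne l hl)]; ring
    have e2 : ∑ l ∈ L, (a l c * ((if l = c then 1 else -1) * 1) +
        ∑ l' ∈ L, a l l' * ((if l = c then 1 else -1) * if l' = c then 1 else -1)) =
          -∑ l ∈ L, a l c := by
      rw [← Finset.sum_neg_distrib]
      refine Finset.sum_congr rfl fun l hl => ?_
      rw [Finset.sum_eq_zero fun l' hl' => by rw [hL l hl l' hl', zero_mul], if_neg (hne l hl)]
      ring
    rw [e1, e2, Finset.sum_add_distrib]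
    linarith

end GroupedSigning

/-- Leaves of weight above `K` become singletons, each losing at most two from the star weight. The
remaining group weighs at most `Δ + Δ * K`, because a centre of weight at most `Δ` has at most `Δ`
leaves. -/
theorem SimpleGraph.StarPacking.groupedSigning {V : Type*} [DecidableEq V] {G : SimpleGraph V}
    {w : V → V → ℕ} {a : V → V → ℝ} {wt : V → ℝ} {Δ K : ℝ}
    (haG : ∀ u v, ¬ G.Adj u v → a u v = 0) (haw : ∀ u v, (w u v : ℝ) = a u v + a v u)
    (hw2 : ∀ u v, w u v ≤ 2) (hΔ : 0 ≤ Δ) (hK : 0 ≤ K)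
    (hdeg : ∀ c (L : Finset V), (∀ l ∈ L, G.Adj c l) → (L.card : ℝ) ≤ wt c)
    {S : Finset V} {k : ℕ} (h : G.StarPacking w S k) (hS : ∀ v ∈ S, wt v ≤ Δ) :
    GroupedSigning a wt (Δ + Δ * K) S (-k + 2 * ((S.filter fun v => K < wt v).card : ℝ)) := by
  have hM : 0 ≤ Δ + Δ * K := by positivity
  have hΔM : Δ ≤ Δ + Δ * K := le_add_of_nonneg_right (by positivity)
  have ha0 : ∀ v, a v v = 0 := fun v => haG v v (G.loopless.irrefl v)
  induction h with
  | empty => exact (GroupedSigning.singletons hM ha0 (by simp)).mono (by simp)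
  | @star S k c L hSk hc hdis hcL hadj hind ih =>
    have h1 := ih fun v hv => hS v (by simp [hv])
    have hlow : GroupedSigning a wt (Δ + Δ * K) (insert c (L.filter fun v => wt v ≤ K))
        (-∑ l ∈ L with wt l ≤ K, (a c l + a l c)) := by
      refine .star hM ha0 (fun h => hcL (Finset.mem_filter.1 h).1)
        (fun l hl l' hl' => haG _ _ (hind l (Finset.mem_filter.1 hl).1 l'
          (Finset.mem_filter.1 hl').1)) ?_
      have hcΔ : wt c ≤ Δ := hS c (by simp)
      have hsum : ∑ l ∈ L with wt l ≤ K, wt l ≤ (L.card : ℝ) * K := by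
        refine (Finset.sum_le_card_nsmul _ _ K fun l hl => (Finset.mem_filter.1 hl).2).trans ?_
        rw [nsmul_eq_mul]
        gcongr
        exact Finset.filter_subset _ _
      have : (L.card : ℝ) * K ≤ Δ * K := by
        gcongr
        exact (hdeg c L hadj).trans hcΔ
      linarith
    have hhigh : GroupedSigning a wt (Δ + Δ * K) (L.filter fun v => K < wt v) 0 :=
      .singletons hM ha0 fun v hv => (hS v (by
        simp [(Finset.mem_filter.1 hv).1])).trans hΔM
    have hsplit : insert c L =
        insert c (L.filter fun v => wt v ≤ K) ∪ L.filter fun v => K < wt v := by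
      ext v
      simp only [Finset.mem_union, Finset.mem_insert, Finset.mem_filter]
      have := le_or_gt (wt v) K
      tauto
    have hdS : Disjoint S (insert c L) := by
      rw [Finset.disjoint_insert_right]
      exact ⟨hc, hdis⟩
    have h2 := hlow.union hhigh (by
      rw [Finset.disjoint_insert_left]
      refine ⟨fun h => hcL (Finset.mem_filter.1 h).1, ?_⟩
      rw [Finset.disjoint_filter]
      intro v _ h3 h4
      linarith)
    rw [← hsplit] at h2
    refine (h1.union h2 hdS).mono ?_
    have hcard : ((L.filter fun v => K < wt v).card : ℝ) ≤
        ((insert c L).filter fun v => K < wt v).card := by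
      exact_mod_cast Finset.card_le_card (Finset.filter_subset_filter _ (Finset.subset_insert _ _))
    have hw : (∑ l ∈ L, w c l : ℝ) ≤ ∑ l ∈ L with wt l ≤ K, (a c l + a l c) +
        2 * (L.filter fun v => K < wt v).card := by
      rw [← Finset.sum_filter_add_sum_filter_not L (fun v => wt v ≤ K)]
      refine add_le_add (le_of_eq (Finset.sum_congr rfl fun l _ => haw c l)) ?_
      simp only [not_le]
      refine (Finset.sum_le_card_nsmul _ _ 2 fun l _ => by exact_mod_cast hw2 c l).trans ?_
      rw [nsmul_eq_mul, mul_comm]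
    rw [Finset.filter_union, Finset.card_union_of_disjoint (Finset.disjoint_filter_filter hdS)]
    push_cast
    linarith

/-! ### Counting arcs and bounding the number of essential tight components. -/

namespace Digraph

section Counting

variable {V : Type*} (D : Digraph V)

open Classical in
/-- The number (zero or one) of arcs from `u` to `v`. -/
noncomputable def mult (u v : V) : ℕ := if D.Adj u v then 1 else 0

theorem mult_le_one (u v : V) : D.mult u v ≤ 1 := by
  unfold mult; split_ifs <;> simp

variable {D} in
theorem mult_eq_zero {u v : V} : D.mult u v = 0 ↔ ¬ D.Adj u v := by
  simp [mult]

variable {D} in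
theorem mult_eq_one {u v : V} : D.mult u v = 1 ↔ D.Adj u v := by
  simp [mult]

theorem arcCount_eq_sum (A B : Finset V) : D.arcCount A B = ∑ u ∈ A, ∑ v ∈ B, D.mult u v := by
  unfold arcCount mult
  rw [Finset.card_filter, Finset.sum_product]

theorem two_mul_arcCount_self_le {D : Digraph V} [DecidableEq V] (hl : D.Loopless) {S : Finset V}
    (hS : ∀ u ∈ S, ∀ v ∈ S, ¬ (D.Adj u v ∧ D.Adj v u)) :
    2 * D.arcCount S S + S.card ≤ S.card * S.card := by
  have h1 : 2 * D.arcCount S S = ∑ u ∈ S, ∑ v ∈ S, (D.mult u v + D.mult v u) := by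
    simp only [Finset.sum_add_distrib, arcCount_eq_sum]
    rw [Finset.sum_comm (f := fun u v => D.mult v u)]
    ring
  have h2 : S.card = ∑ u ∈ S, ∑ v ∈ S, if u = v then 1 else 0 := by
    rw [Finset.card_eq_sum_ones]
    exact Finset.sum_congr rfl fun u hu => by simp [hu]
  have h3 : S.card * S.card = ∑ u ∈ S, ∑ v ∈ S, 1 := by simp
  rw [h3, h1]
  nth_rewrite 1 [h2]
  simp only [← Finset.sum_add_distrib]
  refine Finset.sum_le_sum fun u hu => Finset.sum_le_sum fun v hv => ?_
  by_cases huv : u = v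
  · subst huv
    simp [mult_eq_zero.2 (hl u)]
  · have := hS u hu v hv
    unfold mult
    simp only [huv, if_false]
    split_ifs <;> simp_all

variable [Fintype V]

theorem outDeg_eq_sum (x : V) : D.outDeg x = ∑ y, D.mult x y := by
  simp only [outDeg, mult, Finset.card_filter]

theorem inDeg_eq_sum (x : V) : D.inDeg x = ∑ y, D.mult y x := by
  simp only [inDeg, mult, Finset.card_filter]

theorem imbalance_eq_abs (x : V) : D.imbalance x = |(D.outDeg x : ℤ) - D.inDeg x| := by
  unfold imbalance
  rw [abs_eq_max_neg, neg_sub]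

theorem imbalance_nonneg (x : V) : 0 ≤ D.imbalance x := by
  rw [imbalance_eq_abs]; positivity

theorem imbalance_le_deg (x : V) : D.imbalance x ≤ D.deg x := by
  unfold imbalance deg
  push_cast
  apply max_le <;> omega

theorem two_mul_inDeg_le (x : V) : 2 * (D.inDeg x : ℤ) ≤ D.deg x + D.imbalance x := by
  have : (D.inDeg x : ℤ) - D.outDeg x ≤ D.imbalance x := le_max_right _ _
  unfold deg
  push_cast
  linarith

theorem deg_sub_imbalance_le (x : V) : (D.deg x : ℤ) - D.imbalance x ≤ 2 * D.outDeg x := by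
  have : (D.inDeg x : ℤ) - D.outDeg x ≤ D.imbalance x := le_max_right _ _
  unfold deg
  push_cast
  linarith

theorem sum_outDeg : ∑ x, D.outDeg x = D.arcCount Finset.univ Finset.univ := by
  simp only [arcCount_eq_sum, outDeg_eq_sum]

theorem sum_inDeg : ∑ x, D.inDeg x = D.arcCount Finset.univ Finset.univ := by
  simp only [arcCount_eq_sum, inDeg_eq_sum]
  exact Finset.sum_comm

theorem sum_deg : ∑ x, D.deg x = 2 * D.arcCount Finset.univ Finset.univ := by
  simp only [deg, Finset.sum_add_distrib, sum_outDeg, sum_inDeg]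
  ring

variable {D} [DecidableEq V]

theorem le_card_add_arcCount {d : ℕ} (hl : D.Loopless) (hd : ∀ v, d ≤ D.outDeg v)
    {S Z H : Finset V} (hne : S.Nonempty)
    (hS : ∀ u ∈ S, ∀ v ∈ S, ¬ (D.Adj u v ∧ D.Adj v u))
    (hout : ∀ u ∈ S, ∀ v, D.Adj u v → v ∈ S ∨ v ∈ H ∨ v ∈ Z) :
    (2 * ((d : ℤ) - H.card) + 1) ≤ S.card + 2 * D.arcCount S Z := by
  have h1 : S.card * d ≤ D.arcCount S S + S.card * H.card + D.arcCount S Z := by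
    have e : ∀ u ∈ S, d ≤ ∑ v ∈ S, D.mult u v + H.card + ∑ v ∈ Z, D.mult u v := by
      intro u hu
      refine (hd u).trans ?_
      rw [outDeg_eq_sum]
      have : ∑ v, D.mult u v ≤ ∑ v, ((if v ∈ S then D.mult u v else 0) +
          (if v ∈ H then 1 else 0) + if v ∈ Z then D.mult u v else 0) := by
        refine Finset.sum_le_sum fun v _ => ?_
        by_cases hv : D.Adj u v
        · have h1 := mult_eq_one.2 hv
          rcases hout u hu v hv with h | h | h <;> simp only [h, if_true, h1] <;> omega
        · simp [mult_eq_zero.2 hv]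
      simpa [Finset.sum_add_distrib] using this
    have := Finset.sum_le_sum e
    simpa [Finset.sum_add_distrib, ← arcCount_eq_sum] using this
  have h2 := two_mul_arcCount_self_le hl hS
  have hpos := hne.card_pos
  zify at h1 h2 hpos
  have h0 : (0 : ℤ) ≤ D.arcCount S Z := by positivity
  by_cases hk : 2 * ((d : ℤ) - H.card) + 1 ≤ S.card
  · linarith
  · push Not at hk
    -- With `t = |S|` and `N = 2(d - |H|) + 1`, counting gives `2e(S, Z) ≥ t(N - t)`, and this is at
    -- least `N - t` when `1 ≤ t < N`.
    nlinarith [mul_nonneg (by linarith : (0 : ℤ) ≤ S.card - 1)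
      (by linarith : (0 : ℤ) ≤ 2 * ((d : ℤ) - H.card) + 1 - S.card)]

theorem numEssentialTight_mul_le {d : ℕ} (hl : D.Loopless) (hd : ∀ v, d ≤ D.outDeg v)
    {X Y : Finset V} (hu : X ∪ Y = Finset.univ) :
    ((D.inducedOn (Y : Set V)).numEssentialTight : ℤ) * (2 * ((d : ℤ) - (D.huge X Y).card) + 1) ≤
      Fintype.card V + 2 * D.smallSum X Y + ∑ x ∈ X, ((D.deg x : ℤ) - D.imbalance x) := by
  classical
  set H := (D.inducedOn (Y : Set V)).toSimpleGraphInclusive with hHdef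
  set Z := X \ D.huge X Y with hZ
  set E : Finset H.ConnectedComponent :=
    Finset.univ.filter fun T => (D.inducedOn (Y : Set V)).IsEssentialTight T with hE
  have hcard : (D.inducedOn (Y : Set V)).numEssentialTight = E.card := by
    unfold numEssentialTight
    rw [Set.ncard_eq_toFinset_card', Set.toFinset_ofPred]
  let f : H.ConnectedComponent → Finset V := fun T =>
    T.supp.toFinset.map (Function.Embedding.subtype _)
  have hf : ∀ T v, v ∈ f T ↔ ∃ h : v ∈ (Y : Set V), H.connectedComponentMk ⟨v, h⟩ = T := by
    intro T v
    simp [f]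
  have hdis : ((E : Finset H.ConnectedComponent) : Set H.ConnectedComponent).PairwiseDisjoint f := by
    intro S _ T _ hST
    rw [Function.onFun, Finset.disjoint_left]
    intro v h1 h2
    obtain ⟨h, h1⟩ := (hf _ _).1 h1
    obtain ⟨h', h2⟩ := (hf _ _).1 h2
    exact hST (h1.symm.trans h2)
  have hT : ∀ T ∈ E, (2 * ((d : ℤ) - (D.huge X Y).card) + 1) ≤
      (f T).card + 2 * D.arcCount (f T) Z := by
    intro T hT
    have hess := (Finset.mem_filter.1 hT).2
    refine le_card_add_arcCount hl hd ?_ ?_ ?_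
    · obtain ⟨v, hv⟩ := T.nonempty_supp
      exact ⟨v, (hf _ _).2 ⟨v.2, hv⟩⟩
    · intro u hu v hv
      obtain ⟨hu, hu'⟩ := (hf _ _).1 hu
      obtain ⟨hv, hv'⟩ := (hf _ _).1 hv
      exact hess.2 ⟨u, hu⟩ hu' ⟨v, hv⟩ hv'
    · intro u hu' v huv
      obtain ⟨huY, hu'⟩ := (hf _ _).1 hu'
      by_cases hvX : v ∈ X
      · by_cases hvh : v ∈ D.huge X Y
        · exact Or.inr (Or.inl hvh)
        · exact Or.inr (Or.inr (by simp [hZ, hvX, hvh]))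
      · left
        have hvY : v ∈ Y := by
          have : v ∈ X ∪ Y := by simp [hu]
          exact (Finset.mem_union.1 this).resolve_left hvX
        refine (hf _ _).2 ⟨hvY, ?_⟩
        rw [← hu']
        have hne : u ≠ v := by
          rintro rfl
          exact hl u huv
        have hadj : H.Adj ⟨u, huY⟩ ⟨v, hvY⟩ := ⟨fun h => hne (congrArg Subtype.val h), Or.inl huv⟩
        exact (SimpleGraph.ConnectedComponent.sound hadj.reachable).symm
  have hsum := Finset.sum_le_sum hT
  rw [Finset.sum_const, nsmul_eq_mul, ← hcard] at hsum
  refine hsum.trans ?_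
  rw [Finset.sum_add_distrib, ← Finset.mul_sum]
  have h1 : (∑ T ∈ E, ((f T).card : ℤ)) ≤ Fintype.card V := by
    rw [← Nat.cast_sum, ← Finset.card_biUnion hdis]
    exact_mod_cast Finset.card_le_univ _
  -- The components are disjoint, so each arc into `Z` is counted at most once.
  have h2 : ∑ T ∈ E, (D.arcCount (f T) Z : ℤ) ≤ ∑ x ∈ Z, (D.inDeg x : ℤ) := by
    simp only [arcCount_eq_sum, inDeg_eq_sum]
    norm_cast
    rw [← Finset.sum_biUnion hdis, Finset.sum_comm]
    exact Finset.sum_le_sum fun x _ => Finset.sum_le_sum_of_subset (Finset.subset_univ _)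
  have h3 : 2 * ∑ x ∈ Z, (D.inDeg x : ℤ) ≤
      2 * D.smallSum X Y + ∑ x ∈ Z, ((D.deg x : ℤ) - D.imbalance x) := by
    unfold smallSum
    rw [Finset.mul_sum, Finset.mul_sum, ← Finset.sum_add_distrib]
    exact Finset.sum_le_sum fun x _ => by linarith [D.two_mul_inDeg_le x]
  have h4 : ∑ x ∈ Z, ((D.deg x : ℤ) - D.imbalance x) ≤
      ∑ x ∈ X, ((D.deg x : ℤ) - D.imbalance x) :=
    Finset.sum_le_sum_of_subset_of_nonneg Finset.sdiff_subset
      fun x _ _ => sub_nonneg.2 (D.imbalance_le_deg x)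
  linarith

theorem sum_mult_of_arcCount_self_eq_zero {X Y : Finset V} (hd : Disjoint X Y)
    (hu : X ∪ Y = Finset.univ) (h0 : D.arcCount X X = 0) {x : V} (hx : x ∈ X) :
    D.outDeg x = ∑ y ∈ Y, D.mult x y ∧ D.inDeg x = ∑ y ∈ Y, D.mult y x := by
  have hz : ∀ u ∈ X, ∀ v ∈ X, D.mult u v = 0 := by
    rw [arcCount_eq_sum, Finset.sum_eq_zero_iff] at h0
    exact fun u hu v hv => Finset.sum_eq_zero_iff.1 (h0 u hu) v hv
  rw [outDeg_eq_sum, inDeg_eq_sum, ← hu, Finset.sum_union hd, Finset.sum_union hd,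
    Finset.sum_eq_zero (fun v hv => hz x hx v hv), Finset.sum_eq_zero (fun v hv => hz v hv x hx)]
  simp

theorem gap_eq_sum {X Y : Finset V} (hd : Disjoint X Y) (hu : X ∪ Y = Finset.univ)
    (h0 : D.arcCount X X = 0) {X₁ X₂ : Finset V} (h1 : X₁ ⊆ X) (h2 : X₂ ⊆ X) :
    D.gap Y X₁ X₂ = ∑ x ∈ X₁, ((D.outDeg x : ℤ) - D.inDeg x) -
      ∑ x ∈ X₂, ((D.outDeg x : ℤ) - D.inDeg x) := by
  have key : ∀ A ⊆ X, (D.arcCount A Y : ℤ) = ∑ x ∈ A, (D.outDeg x : ℤ) ∧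
      (D.arcCount Y A : ℤ) = ∑ x ∈ A, (D.inDeg x : ℤ) := by
    intro A hA
    have := fun x hx => sum_mult_of_arcCount_self_eq_zero hd hu h0 (hA hx : x ∈ X)
    simp only [arcCount_eq_sum]
    rw [Finset.sum_comm (s := Y)]
    norm_cast
    exact ⟨Finset.sum_congr rfl fun x hx => (this x hx).1.symm,
      Finset.sum_congr rfl fun x hx => (this x hx).2.symm⟩
  unfold gap
  rw [(key _ h1).1, (key _ h1).2, (key _ h2).1, (key _ h2).2, Finset.sum_sub_distrib,
    Finset.sum_sub_distrib]
  ring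

theorem imbalance_le_card {X Y : Finset V} (hd : Disjoint X Y) (hu : X ∪ Y = Finset.univ)
    (h0 : D.arcCount X X = 0) {x : V} (hx : x ∈ X) : D.imbalance x ≤ Y.card := by
  obtain ⟨h1, h2⟩ := sum_mult_of_arcCount_self_eq_zero hd hu h0 hx
  have h3 : D.outDeg x ≤ Y.card := by
    rw [h1]
    simpa using Finset.sum_le_card_nsmul Y _ 1 fun y _ => D.mult_le_one x y
  have h4 : D.inDeg x ≤ Y.card := by
    rw [h2]
    simpa using Finset.sum_le_card_nsmul Y _ 1 fun y _ => D.mult_le_one y x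
  unfold imbalance
  apply max_le <;> omega

end Counting

end Digraph

/-! ### The minimum gap when there is one huge vertex. -/

/-- If `t ≤ |f a|` and all other values of `|f|` are smaller than `t`, then flipping signs greedily
either brings the signed sum below `t`, or `|f a|` exceeds the other values by `t` in total. -/
theorem exists_signs_abs_sum_lt {ι : Type*} [DecidableEq ι] (f : ι → ℤ) (t : ℤ) (a : ι)
    (ha : t ≤ |f a|) (F : Finset ι) (haF : a ∉ F) (hF : ∀ x ∈ F, |f x| < t) :
    (t ≤ |f a| - ∑ x ∈ F, |f x|) ∨
      ∃ e : ι → ℤ, (∀ x, e x = 1 ∨ e x = -1) ∧ |∑ x ∈ insert a F, e x * f x| < t := by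
  have hsign : ∀ (z y : ℤ), ∃ e : ℤ, (e = 1 ∨ e = -1) ∧ (0 ≤ z → z + e * y = z - |y|) ∧
      (z < 0 → z + e * y = z + |y|) := by
    intro z y
    rcases le_or_gt 0 z with hz | hz <;> rcases le_total 0 y with hy | hy
    · exact ⟨-1, by simp, fun _ => by rw [abs_of_nonneg hy]; ring, fun h => by omega⟩
    · exact ⟨1, by simp, fun _ => by rw [abs_of_nonpos hy]; ring, fun h => by omega⟩
    · exact ⟨1, by simp, fun h => by omega, fun _ => by rw [abs_of_nonneg hy]; ring⟩
    · exact ⟨-1, by simp, fun h => by omega, fun _ => by rw [abs_of_nonpos hy]; ring⟩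
  have habs : ∀ (e : ι → ℤ) (s : Finset ι), (∀ x, e x = 1 ∨ e x = -1) → ∀ x, x ∉ s →
      ∀ c : ℤ, (c = 1 ∨ c = -1) → ∃ e' : ι → ℤ, (∀ x, e' x = 1 ∨ e' x = -1) ∧
        ∑ y ∈ insert x s, e' y * f y = ∑ y ∈ s, e y * f y + c * f x := by
    intro e s he x hx c hc
    refine ⟨Function.update e x c, fun y => ?_, ?_⟩
    · by_cases h : y = x
      · subst h; simpa
      · simpa [h] using he y
    · rw [Finset.sum_insert hx, Function.update_self, add_comm]
      congr 1
      exact Finset.sum_congr rfl fun y hy => by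
        rw [Function.update_of_ne (by rintro rfl; exact hx hy)]
  induction F using Finset.induction_on with
  | empty => left; simpa
  | insert x F hx ih =>
    have hxa : x ∉ insert a F := by
      simp only [Finset.mem_insert, not_or]
      exact ⟨by rintro rfl; simp at haF, hx⟩
    have hxt := hF x (by simp)
    rcases ih (fun h => haF (by simp [h])) (fun y hy => hF y (by simp [hy])) with h | ⟨e, he, hlt⟩
    · by_cases h' : t ≤ |f a| - ∑ y ∈ insert x F, |f y|
      · exact Or.inl h'
      -- The previous difference was at least `t` and `|f x| < t`, so the first difference to drop
      -- below `t` is still positive.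
      · right
        rw [Finset.sum_insert hx] at h'
        refine ⟨fun y => if y = a then (if 0 ≤ f a then 1 else -1) else
          (if 0 ≤ f y then -1 else 1), fun y => by dsimp only; split_ifs <;> simp, ?_⟩
        have e1 : ∑ y ∈ insert a (insert x F), (if y = a then (if 0 ≤ f a then 1 else -1) else
            (if 0 ≤ f y then -1 else 1)) * f y = |f a| - ∑ y ∈ insert x F, |f y| := by
          rw [Finset.sum_insert haF, sub_eq_add_neg, ← Finset.sum_neg_distrib]
          congr 1
          · rw [if_pos rfl]
            split_ifs
            · rw [abs_of_nonneg ‹_›]; ring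
            · rw [abs_of_neg (by omega)]; ring
          · refine Finset.sum_congr rfl fun y hy => ?_
            rw [if_neg (by rintro rfl; exact haF hy)]
            split_ifs with h2
            · rw [abs_of_nonneg h2]; ring
            · rw [abs_of_neg (by omega)]; ring
        rw [e1, Finset.sum_insert hx, abs_lt]
        constructor <;> linarith [abs_nonneg (f x)]
    -- Once the sum lies within `(-t, t)`, giving `f x` the sign opposite to the sum keeps it there.
    · right
      obtain ⟨c, hc, h1, h2⟩ := hsign (∑ y ∈ insert a F, e y * f y) (f x)
      obtain ⟨e', he', hsum⟩ := habs e _ he x hxa c hc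
      refine ⟨e', he', ?_⟩
      rw [Finset.insert_comm, hsum]
      rw [abs_lt] at hlt ⊢
      have := abs_nonneg (f x)
      rcases le_or_gt 0 (∑ y ∈ insert a F, e y * f y) with hz | hz
      · rw [h1 hz]; constructor <;> linarith
      · rw [h2 hz]; constructor <;> linarith

namespace Digraph

variable {V : Type*} {D : Digraph V} [Fintype V] [DecidableEq V]

/-- Since `e(X) = 0`, gaps are signed sums of `d⁺ - d⁻` over `X`. If the small vertices could pull
`s(x₀)` below `θ`, some partition would have gap smaller than the minimum. -/
theorem minGap_add_smallSum_le {X Y : Finset V} (hd : Disjoint X Y) (hu : X ∪ Y = Finset.univ)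
    (h0 : D.arcCount X X = 0) {x₀ : V} (hx₀ : D.huge X Y = {x₀}) :
    D.minGap X Y + D.smallSum X Y ≤ D.imbalance x₀ := by
  have hmem : x₀ ∈ D.huge X Y := by simp [hx₀]
  obtain ⟨hxX, hle⟩ := Finset.mem_filter.1 hmem
  have hsmall : ∀ x ∈ X \ D.huge X Y, |(D.outDeg x : ℤ) - D.inDeg x| < D.minGap X Y := by
    intro x hx
    obtain ⟨h1, h2⟩ := Finset.mem_sdiff.1 hx
    rw [← imbalance_eq_abs]
    by_contra h
    exact h2 (Finset.mem_filter.2 ⟨h1, not_lt.1 h⟩)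
  rw [imbalance_eq_abs] at hle
  rcases exists_signs_abs_sum_lt (fun x => (D.outDeg x : ℤ) - D.inDeg x) (D.minGap X Y) x₀ hle
    (X \ D.huge X Y) (by simp [hmem]) hsmall with h | ⟨e, he, hlt⟩
  · rw [imbalance_eq_abs]
    unfold smallSum
    simp only [imbalance_eq_abs]
    linarith
  · exfalso
    rw [hx₀, ← Finset.erase_eq, Finset.insert_erase hxX] at hlt
    have hmin : D.minGap X Y ≤ |D.gap Y (X.filter (e · = 1)) (X \ X.filter (e · = 1))| :=
      Finset.inf'_le _ (Finset.mem_powerset.2 (Finset.filter_subset _ _))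
    rw [gap_eq_sum hd hu h0 (Finset.filter_subset _ _) Finset.sdiff_subset] at hmin
    have : ∑ x ∈ X, e x * ((D.outDeg x : ℤ) - D.inDeg x) =
        ∑ x ∈ X with e x = 1, ((D.outDeg x : ℤ) - D.inDeg x) -
        ∑ x ∈ X \ X.filter (e · = 1), ((D.outDeg x : ℤ) - D.inDeg x) := by
      rw [← Finset.filter_not, ← Finset.sum_filter_add_sum_filter_not X (e · = 1), sub_eq_add_neg,
        ← Finset.sum_neg_distrib]
      congr 1
      · exact Finset.sum_congr rfl fun x hx => by rw [(Finset.mem_filter.1 hx).2, one_mul]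
      · exact Finset.sum_congr rfl fun x hx => by
          rw [(he x).resolve_left (Finset.mem_filter.1 hx).2]; ring
    rw [← this] at hmin
    exact absurd hlt (not_lt.2 hmin)

end Digraph

/-! ### From star packings to balanced bipartitions. -/

namespace Digraph

variable {V : Type*} {D : Digraph V} [Fintype V] [DecidableEq V]

/-- The weight counts opposite arcs twice, so weight at most one on a tight component means that it
is essential. -/
theorem exists_starPacking (hl : D.Loopless) (Y : Finset V) :
    ∃ k, D.toSimpleGraphInclusive.StarPacking (fun u v => D.mult u v + D.mult v u) Y k ∧
      Y.card ≤ 2 * k + (D.inducedOn (Y : Set V)).numEssentialTight := by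
  classical
  obtain ⟨k, hk, hcard⟩ := (D.inducedOn (Y : Set V)).toSimpleGraphInclusive.exists_starPacking
    (w := fun u v => D.mult u v + D.mult v u) (by
      rintro a b ⟨-, h | h⟩
      · have := mult_eq_one.2 (show D.Adj a b from h)
        omega
      · have := mult_eq_one.2 (show D.Adj b a from h)
        omega)
  have hcomap : D.toSimpleGraphInclusive.comap (Function.Embedding.subtype (· ∈ (Y : Set V))) =
      (D.inducedOn (Y : Set V)).toSimpleGraphInclusive := by
    ext a b
    exact ⟨fun h => ⟨fun e => h.1 (congrArg Subtype.val e), h.2⟩,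
      fun h => ⟨fun e => h.1 (Subtype.ext e), h.2⟩⟩
  have hmap := SimpleGraph.StarPacking.map (G := D.toSimpleGraphInclusive)
    (w := fun u v => D.mult u v + D.mult v u)
    (Function.Embedding.subtype (· ∈ (Y : Set V))) (by rw [hcomap]; exact hk)
  refine ⟨k, ?_, ?_⟩
  · convert hmap using 1
    ext; simp
  · have h1 : Fintype.card (Y : Set V) = Y.card := by simp
    rw [← h1]
    refine hcard.trans (Nat.add_le_add_left (Set.ncard_le_ncard ?_) _)
    rintro T ⟨h1, h2⟩
    refine ⟨h1, fun u hu v hv huv => ?_⟩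
    have hne : u ≠ v := by
      rintro rfl
      exact hl _ huv.1
    have := h2 u hu v hv ⟨hne, Or.inl huv.1⟩
    have e1 := mult_eq_one.2 (show D.Adj u v from huv.1)
    have e2 := mult_eq_one.2 (show D.Adj v u from huv.2)
    omega

/-- An arc `uv` contributes `(1 + x u)(1 - x v)`, which is four when it goes from the positive to
the negative side and zero otherwise. -/
theorem four_mul_arcCount_filter {V : Type*} {D : Digraph V} [Fintype V] {x : V → ℝ} (hx : ∀ v, x v = 1 ∨ x v = -1) :
    4 * (D.arcCount {v | x v = 1} {v | x v = -1} : ℝ) = D.arcCount Finset.univ Finset.univ +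
      ∑ v, ((D.outDeg v : ℝ) - D.inDeg v) * x v - ∑ u, ∑ v, (D.mult u v : ℝ) * (x u * x v) := by
  have hL : ∑ v, ((D.outDeg v : ℝ) - D.inDeg v) * x v =
      ∑ u, ∑ v, (D.mult u v : ℝ) * (x u - x v) := by
    simp only [sub_mul, mul_sub, Finset.sum_sub_distrib, outDeg_eq_sum, inDeg_eq_sum,
      Nat.cast_sum, Finset.sum_mul]
    congr 1
    rw [Finset.sum_comm]
  rw [hL, arcCount_eq_sum, arcCount_eq_sum, Finset.sum_filter]
  push_cast
  rw [Finset.mul_sum, ← Finset.sum_add_distrib, ← Finset.sum_sub_distrib]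
  refine Finset.sum_congr rfl fun u _ => ?_
  rw [← Finset.sum_add_distrib, ← Finset.sum_sub_distrib, Finset.sum_filter]
  rcases hx u with hu | hu
  · rw [if_pos hu, Finset.mul_sum]
    refine Finset.sum_congr rfl fun v _ => ?_
    rcases hx v with hv | hv <;> rw [hu, hv] <;> norm_num
    ring
  · rw [if_neg (by rw [hu]; norm_num), mul_zero]
    refine (Finset.sum_eq_zero fun v _ => ?_).symm
    rcases hx v with hv | hv <;> rw [hu, hv] <;> ring

end Digraph

/-- Each group is contracted to one index, so the diagonal consists of the pairs inside a group. -/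
theorem exists_signs_grouped {V ι : Type*} [Fintype ι] [DecidableEq ι] (F : Finset V) (g : V → ι)
    (c : V → V → ℝ) (b : V → ℝ) : ∃ σ : ι → ℝ, (∀ i, σ i = 1 ∨ σ i = -1) ∧
      ∑ u ∈ F, ∑ v ∈ F, c u v * (σ (g u) * σ (g v)) + ∑ u ∈ F, b u * σ (g u) ≤
        ∑ u ∈ F, ∑ v ∈ F, if g u = g v then c u v else 0 := by
  obtain ⟨σ, hσ, h⟩ := exists_signs_quadratic Finset.univ
    (fun i j => ∑ u ∈ F, ∑ v ∈ F, if g u = i ∧ g v = j then c u v else 0)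
    (fun i => ∑ u ∈ F, if g u = i then b u else 0)
  have swap : ∀ t : ι → ι → V → V → ℝ, ∑ i, ∑ j, ∑ u ∈ F, ∑ v ∈ F, t i j u v =
      ∑ u ∈ F, ∑ v ∈ F, ∑ i, ∑ j, t i j u v := fun t =>
    calc ∑ i, ∑ j, ∑ u ∈ F, ∑ v ∈ F, t i j u v = ∑ i, ∑ u ∈ F, ∑ j, ∑ v ∈ F, t i j u v :=
          Finset.sum_congr rfl fun i _ => Finset.sum_comm
      _ = ∑ u ∈ F, ∑ i, ∑ j, ∑ v ∈ F, t i j u v := Finset.sum_comm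
      _ = ∑ u ∈ F, ∑ i, ∑ v ∈ F, ∑ j, t i j u v :=
          Finset.sum_congr rfl fun u _ => Finset.sum_congr rfl fun i _ => Finset.sum_comm
      _ = ∑ u ∈ F, ∑ v ∈ F, ∑ i, ∑ j, t i j u v :=
          Finset.sum_congr rfl fun u _ => Finset.sum_comm
  have e1 : ∑ i, ∑ j, (∑ u ∈ F, ∑ v ∈ F, if g u = i ∧ g v = j then c u v else 0) * (σ i * σ j) =
      ∑ u ∈ F, ∑ v ∈ F, c u v * (σ (g u) * σ (g v)) := by
    simp only [Finset.sum_mul]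
    rw [swap]
    refine Finset.sum_congr rfl fun u _ => Finset.sum_congr rfl fun v _ => ?_
    simp [ite_and, ite_mul]
  have e2 : ∑ i, (∑ u ∈ F, if g u = i then b u else 0) * σ i = ∑ u ∈ F, b u * σ (g u) := by
    simp only [Finset.sum_mul]
    rw [Finset.sum_comm]
    exact Finset.sum_congr rfl fun u _ => by simp [ite_mul]
  have e3 : ∑ i, ∑ u ∈ F, ∑ v ∈ F, (if g u = i ∧ g v = i then c u v else 0) =
      ∑ u ∈ F, ∑ v ∈ F, if g u = g v then c u v else 0 := by
    rw [Finset.sum_comm]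
    refine Finset.sum_congr rfl fun u _ => ?_
    rw [Finset.sum_comm]
    refine Finset.sum_congr rfl fun v _ => ?_
    simp [ite_and, eq_comm]
  rw [e1, e2, e3] at h
  exact ⟨σ, hσ, h⟩

namespace Digraph

variable {V : Type*} {D : Digraph V} [Fintype V] [DecidableEq V]

/-- A partition of `X` and a grouped signing of `Y` extend to a bipartition of the digraph. The
parameter `l` trades the balance of the bipartition for the number of arcs it cuts. -/
theorem exists_bipartition {X Y X₁ : Finset V} (hd : Disjoint X Y) (hu : X ∪ Y = Finset.univ)
    (h0 : D.arcCount X X = 0) (hX₁ : X₁ ⊆ X) {M q l : ℝ} (hM0 : 0 ≤ M) (hl : 0 ≤ l)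
    (hsig : GroupedSigning (fun u v => (D.mult u v : ℝ)) (fun v => (D.deg v : ℝ)) M Y q) :
    ∃ V₁ V₂ : Finset V, Disjoint V₁ V₂ ∧ V₁ ∪ V₂ = Finset.univ ∧ ∃ r s : ℝ,
      -(D.arcCount Finset.univ Finset.univ : ℝ) ≤ r ∧
      r + l * s ^ 2 ≤ q + 2 * l * M * D.arcCount Finset.univ Finset.univ ∧
      D.arcCount Finset.univ Finset.univ - r - |(D.gap Y X₁ (X \ X₁) : ℝ)| - |s| ≤
        4 * ((min (D.arcCount V₁ V₂) (D.arcCount V₂ V₁) : ℕ) : ℝ) := by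
  obtain ⟨g, p, hgY, hp, hM, hq⟩ := hsig
  set m := D.arcCount Finset.univ Finset.univ with hm
  set δ : V → ℝ := fun v => (D.outDeg v : ℝ) - D.inDeg v with hδ
  set a : V → V → ℝ := fun u v => (D.mult u v : ℝ) with ha
  have hMX : ∀ u ∈ X, ∀ v ∈ X, a u v = 0 := by
    rw [arcCount_eq_sum, Finset.sum_eq_zero_iff] at h0
    exact fun u hu v hv => by
      simp only [ha, Nat.cast_eq_zero]
      exact Finset.sum_eq_zero_iff.1 (h0 u hu) v hv
  let y : V → ℝ := fun v => if v ∈ X₁ then 1 else -1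
  -- The form to minimise is the arc form plus `l` times the square of the imbalance of `Y`; the
  -- linear part comes from arcs to `X`, whose signs are already fixed.
  obtain ⟨σ, hσ, hle⟩ := exists_signs_grouped Y g
    (fun u v => (a u v + l * (δ u * δ v)) * (p u * p v))
    (fun u => (∑ x ∈ X, (a u x + a x u) * y x) * p u)
  let x : V → ℝ := fun v => if v ∈ X then y v else p v * σ (g v)
  have hxX : ∀ v ∈ X, x v = y v := fun v hv => if_pos hv
  have hxY : ∀ v ∈ Y, x v = p v * σ (g v) := fun v hv =>
    if_neg fun h => Finset.disjoint_left.1 hd h hv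
  have hx : ∀ v, x v = 1 ∨ x v = -1 := by
    intro v
    simp only [x, y]
    split_ifs
    · simp
    · simp
    · rcases hp v with h | h <;> rcases hσ (g v) with h' | h' <;> rw [h, h'] <;> norm_num
  set s : ℝ := ∑ v ∈ Y, δ v * x v with hs
  set r : ℝ := ∑ u, ∑ v, a u v * (x u * x v) with hr
  have hmin := four_mul_arcCount_filter (D := D) hx
  -- Negating all signs exchanges the two sides: only the linear term changes sign, so both
  -- directions are bounded together.
  have hmin' := four_mul_arcCount_filter (D := D) (x := fun v => -x v) (fun v => by
    rcases hx v with h | h <;> simp [h])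
  simp only [neg_inj, neg_eq_iff_eq_neg (a := x _) (b := (1 : ℝ)), mul_neg,
    Finset.sum_neg_distrib, neg_mul, neg_neg] at hmin'
  have hL : ∑ v, δ v * x v = (D.gap Y X₁ (X \ X₁) : ℝ) + s := by
    rw [← hu, Finset.sum_union hd, gap_eq_sum hd hu h0 hX₁ Finset.sdiff_subset]
    congr 1
    push_cast
    rw [← Finset.sum_sdiff hX₁, add_comm, sub_eq_add_neg, ← Finset.sum_neg_distrib]
    congr 1
    · exact Finset.sum_congr rfl fun v hv => by rw [hxX v (hX₁ hv)]; simp [y, hv, hδ]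
    · exact Finset.sum_congr rfl fun v hv => by
        obtain ⟨h1, h2⟩ := Finset.mem_sdiff.1 hv
        rw [hxX v h1]; simp [y, h2, hδ]
  have hdis : Disjoint (Finset.univ.filter fun v => x v = 1) (Finset.univ.filter fun v => x v = -1) := by
    rw [Finset.disjoint_filter]
    intro v _ h1 h2
    rw [h1] at h2
    norm_num at h2
  refine ⟨Finset.univ.filter fun v => x v = 1, Finset.univ.filter fun v => x v = -1, hdis, ?_,
    r, s, ?_, ?_, ?_⟩
  · ext v
    simpa using hx v
  · have : ∀ v, |x v| = 1 := fun v => by rcases hx v with h | h <;> simp [h]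
    rw [hm, arcCount_eq_sum]
    push_cast
    rw [← Finset.sum_neg_distrib]
    refine Finset.sum_le_sum fun u _ => ?_
    rw [← Finset.sum_neg_distrib]
    refine Finset.sum_le_sum fun v _ => ?_
    have h1 : |x u * x v| = 1 := by rw [abs_mul, this, this, one_mul]
    have h2 : (0 : ℝ) ≤ D.mult u v := by positivity
    have := neg_abs_le (x u * x v)
    rw [h1] at this
    simp only [ha]
    nlinarith
  · have hrsplit : r = ∑ u ∈ Y, ∑ v ∈ Y, a u v * (x u * x v) +
        ∑ u ∈ Y, (∑ v ∈ X, (a u v + a v u) * y v) * x u := by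
      rw [hr, ← hu, Finset.sum_union hd]
      simp only [Finset.sum_union hd, Finset.sum_add_distrib]
      rw [Finset.sum_eq_zero (s := X) (f := fun u => ∑ v ∈ X, _) fun u hu =>
        Finset.sum_eq_zero fun v hv => by rw [hMX u hu v hv, zero_mul]]
      rw [Finset.sum_comm (s := X) (t := Y)]
      have : ∑ u ∈ Y, (∑ v ∈ X, (a u v + a v u) * y v) * x u =
          ∑ u ∈ Y, ∑ v ∈ X, a u v * (x u * x v) + ∑ u ∈ Y, ∑ v ∈ X, a v u * (x v * x u) := by
        rw [← Finset.sum_add_distrib]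
        refine Finset.sum_congr rfl fun u _ => ?_
        rw [← Finset.sum_add_distrib, Finset.sum_mul]
        exact Finset.sum_congr rfl fun v hv => by rw [hxX v hv]; ring
      rw [this]
      ring
    have hs2 : l * s ^ 2 = ∑ u ∈ Y, ∑ v ∈ Y, l * (δ u * δ v) * (x u * x v) := by
      rw [hs, sq, Finset.sum_mul_sum, Finset.mul_sum]
      refine Finset.sum_congr rfl fun u _ => ?_
      rw [Finset.mul_sum]
      exact Finset.sum_congr rfl fun v _ => by ring
    have hlhs : r + l * s ^ 2 = ∑ u ∈ Y, ∑ v ∈ Y,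
        (a u v + l * (δ u * δ v)) * (p u * p v) * (σ (g u) * σ (g v)) +
        ∑ u ∈ Y, (∑ x ∈ X, (a u x + a x u) * y x) * p u * σ (g u) := by
      rw [hrsplit, hs2, add_right_comm, ← Finset.sum_add_distrib]
      congr 1
      · refine Finset.sum_congr rfl fun u hu => ?_
        rw [← Finset.sum_add_distrib]
        exact Finset.sum_congr rfl fun v hv => by rw [hxY u hu, hxY v hv]; ring
      · exact Finset.sum_congr rfl fun u hu => by rw [hxY u hu]; ring
    rw [hlhs]
    refine hle.trans ?_
    have hdelta : ∀ v, |δ v * p v| ≤ D.deg v := by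
      intro v
      have : |p v| = 1 := by rcases hp v with h | h <;> simp [h]
      rw [abs_mul, this, mul_one, abs_le]
      simp only [hδ, deg]
      push_cast
      constructor <;> linarith [(Nat.cast_nonneg (D.outDeg v) : (0 : ℝ) ≤ _),
        (Nat.cast_nonneg (D.inDeg v) : (0 : ℝ) ≤ _)]
    -- This is the variance of the imbalance of `Y` under random flips; each vertex meets a group of
    -- total degree at most `M`.
    have hvar : ∑ u ∈ Y, ∑ v ∈ Y, (if g u = g v then δ u * p u * (δ v * p v) else 0) ≤
        2 * M * m := by
      have h1 : ∀ u ∈ Y, ∑ v ∈ Y, (if g u = g v then δ u * p u * (δ v * p v) else 0) ≤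
          D.deg u * M := by
        intro u hu
        rw [← Finset.sum_filter, ← Finset.mul_sum]
        refine (le_abs_self _).trans ?_
        rw [abs_mul]
        refine mul_le_mul (hdelta u) ?_ (abs_nonneg _) (by positivity)
        refine (Finset.abs_sum_le_sum_abs _ _).trans ((Finset.sum_le_sum fun v _ => hdelta v).trans ?_)
        have := hM (g u)
        simpa [eq_comm] using this
      refine (Finset.sum_le_sum h1).trans ?_
      rw [← Finset.sum_mul]
      have h3 : ∑ u ∈ Y, (D.deg u : ℝ) ≤ 2 * m := by
        refine (Finset.sum_le_sum_of_subset_of_nonneg (Finset.subset_univ Y)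
          fun v _ _ => by positivity).trans ?_
        exact_mod_cast D.sum_deg.le
      nlinarith
    have hsplit : ∑ u ∈ Y, ∑ v ∈ Y, (if g u = g v then
        (a u v + l * (δ u * δ v)) * (p u * p v) else 0) =
        ∑ u ∈ Y, ∑ v ∈ Y, (if g u = g v then a u v * (p u * p v) else 0) +
        l * ∑ u ∈ Y, ∑ v ∈ Y, (if g u = g v then δ u * p u * (δ v * p v) else 0) := by
      rw [Finset.mul_sum, ← Finset.sum_add_distrib]
      refine Finset.sum_congr rfl fun u _ => ?_
      rw [Finset.mul_sum, ← Finset.sum_add_distrib]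
      refine Finset.sum_congr rfl fun v _ => ?_
      split_ifs <;> ring
    rw [hsplit]
    have := mul_le_mul_of_nonneg_left hvar hl
    linarith
  · simp only [δ] at hL
    rw [hL] at hmin hmin'
    rw [Nat.cast_min, mul_min_of_nonneg _ _ (by norm_num : (0 : ℝ) ≤ 4), hmin, hmin', le_min_iff]
    have h1 := abs_le.1 (le_refl |(D.gap Y X₁ (X \ X₁) : ℝ)|)
    have h2 := abs_le.1 (le_refl |s|)
    constructor <;> linarith

theorem exists_gap_eq_minGap {V : Type*} {D : Digraph V} [DecidableEq V] (X Y : Finset V) :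
    ∃ X₁ ⊆ X, |D.gap Y X₁ (X \ X₁)| = D.minGap X Y := by
  obtain ⟨X₁, h1, h2⟩ := Finset.exists_mem_eq_inf' ⟨∅, Finset.empty_mem_powerset X⟩
    fun X₁ => |D.gap Y X₁ (X \ X₁)|
  exact ⟨X₁, Finset.mem_powerset.1 h1, h2.symm⟩

theorem card_le_deg {V : Type*} {D : Digraph V} [Fintype V] {c : V} {L : Finset V} (h : ∀ l ∈ L, D.toSimpleGraphInclusive.Adj c l) :
    L.card ≤ D.deg c := by
  have h1 : ∀ v ∈ L, 1 ≤ D.mult c v + D.mult v c := by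
    intro v hv
    rcases (h v hv).2 with h | h
    · have := mult_eq_one.2 h
      omega
    · have := mult_eq_one.2 h
      omega
  calc L.card = ∑ v ∈ L, 1 := by simp
    _ ≤ ∑ v ∈ L, (D.mult c v + D.mult v c) := Finset.sum_le_sum h1
    _ ≤ ∑ v, (D.mult c v + D.mult v c) := Finset.sum_le_sum_of_subset (Finset.subset_univ _)
    _ = D.deg c := by rw [Finset.sum_add_distrib, deg, outDeg_eq_sum, inDeg_eq_sum]

theorem exists_groupedSigning (hl : D.Loopless) {Y : Finset V} {Δ K : ℝ} (hΔ : 0 ≤ Δ)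
    (hK : 0 ≤ K) (hY : ∀ v ∈ Y, (D.deg v : ℝ) ≤ Δ) :
    ∃ k : ℝ, (Y.card : ℝ) ≤ 2 * k + (D.inducedOn (Y : Set V)).numEssentialTight ∧ 0 ≤ k ∧
      GroupedSigning (fun u v => (D.mult u v : ℝ)) (fun v => (D.deg v : ℝ)) (Δ + Δ * K) Y
        (-k + 2 * ((Y.filter fun v => K < (D.deg v : ℝ)).card : ℝ)) := by
  obtain ⟨k, hk, hcard⟩ := exists_starPacking hl Y
  refine ⟨k, by exact_mod_cast hcard, by positivity, hk.groupedSigning ?_ ?_ ?_ hΔ hK ?_ hY⟩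
  · intro u v huv
    rw [Nat.cast_eq_zero, mult_eq_zero]
    intro h
    exact huv ⟨by rintro rfl; exact hl _ h, Or.inl h⟩
  · intro u v
    push_cast
    ring
  · intro u v
    have := D.mult_le_one u v
    have := D.mult_le_one v u
    omega
  · intro c L h
    exact_mod_cast card_le_deg h

theorem card_high_mul_le {V : Type*} {D : Digraph V} [Fintype V] {Y : Finset V} {K : ℝ} :
    ((Y.filter fun v => K < (D.deg v : ℝ)).card : ℝ) * K ≤
      2 * D.arcCount Finset.univ Finset.univ := by
  calc ((Y.filter fun v => K < (D.deg v : ℝ)).card : ℝ) * K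
      = ∑ v ∈ Y with K < (D.deg v : ℝ), K := by rw [Finset.sum_const, nsmul_eq_mul]
    _ ≤ ∑ v ∈ Y with K < (D.deg v : ℝ), (D.deg v : ℝ) :=
      Finset.sum_le_sum fun v hv => (Finset.mem_filter.1 hv).2.le
    _ ≤ ∑ v, (D.deg v : ℝ) := Finset.sum_le_sum_of_subset_of_nonneg (Finset.subset_univ _)
      fun v _ _ => by positivity
    _ = 2 * D.arcCount Finset.univ Finset.univ := by exact_mod_cast D.sum_deg

theorem balancedHalf_add_le {d : ℕ} (hdeg : ∀ v, d ≤ D.outDeg v) {X Y : Finset V}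
    (hd : Disjoint X Y) (hu : X ∪ Y = Finset.univ) :
    D.balancedHalf X + d * Y.card ≤ D.arcCount Finset.univ Finset.univ := by
  rw [← sum_outDeg, ← hu, Finset.sum_union hd]
  push_cast
  refine add_le_add ?_ ?_
  · unfold balancedHalf
    rw [div_le_iff₀ (by norm_num), Finset.sum_mul]
    have : ∑ x ∈ X, ((D.deg x : ℤ) - D.imbalance x) ≤ ∑ x ∈ X, (D.outDeg x : ℤ) * 2 :=
      Finset.sum_le_sum fun x _ => by linarith [D.deg_sub_imbalance_le x]
    exact_mod_cast this
  · rw [mul_comm, ← nsmul_eq_mul]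
    exact Finset.card_nsmul_le_sum _ _ _ fun v _ => by exact_mod_cast hdeg v

theorem numEssentialTight_mul_le_balancedHalf {d : ℕ} (hl : D.Loopless)
    (hd : ∀ v, d ≤ D.outDeg v) {X Y : Finset V} (hu : X ∪ Y = Finset.univ) :
    ((D.inducedOn (Y : Set V)).numEssentialTight : ℝ) *
        (2 * ((d : ℝ) - (D.huge X Y).card) + 1) ≤
      Fintype.card V + 2 * D.smallSum X Y + 2 * D.balancedHalf X := by
  have h := (Int.cast_le (R := ℝ)).2 (numEssentialTight_mul_le hl hd hu (Y := Y))
  unfold balancedHalf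
  push_cast at h ⊢
  linarith

theorem le_min_arcCount {d : ℕ} (hd4 : 4 ≤ d) {C ε γ K Λ : ℝ} (hε : 0 < ε) (hγ : 0 < γ)
    (hC : 0 < C) (hΛ : Λ = 2 * (2 + C) / ε ^ 2) (hK : K = 16 / ε) (hγε : γ ≤ ε)
    (h1 : γ * (1 + K) ≤ ε / (8 * Λ)) (h2 : γ * (1 + K) ≤ ε ^ 2 / (4 * C))
    (hl : D.Loopless) (hm : (D.arcCount Finset.univ Finset.univ : ℝ) ≤ C * Fintype.card V)
    (hdeg : ∀ v, d ≤ D.outDeg v) {X Y : Finset V} (hd : Disjoint X Y)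
    (hu : X ∪ Y = Finset.univ) (hX : (X.card : ℝ) ≤ γ * Fintype.card V)
    (h0 : D.arcCount X X = 0) (hY : ∀ y ∈ Y, (D.deg y : ℝ) ≤ γ * Fintype.card V)
    (hh : (D.huge X Y).card = 1) :
    ∃ V₁ V₂ : Finset V, Disjoint V₁ V₂ ∧ V₁ ∪ V₂ = Finset.univ ∧
      (((d : ℝ) - 1) / (2 * (2 * (d : ℝ) - 1)) - ε) * (D.arcCount Finset.univ Finset.univ : ℝ) ≤
        ((min (D.arcCount V₁ V₂) (D.arcCount V₂ V₁) : ℕ) : ℝ) := by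
  obtain ⟨x₀, hx₀⟩ := Finset.card_eq_one.1 hh
  have hx₀X : x₀ ∈ X := by
    have : x₀ ∈ D.huge X Y := by simp [hx₀]
    exact (Finset.mem_filter.1 this).1
  set n : ℝ := (Fintype.card V : ℝ) with hn
  have hn0 : 0 < n := by
    have : 0 < Fintype.card V := Fintype.card_pos_iff.2 ⟨x₀⟩
    rw [hn]
    exact_mod_cast this
  set m : ℝ := (D.arcCount Finset.univ Finset.univ : ℝ) with hmdef
  have hd4' : (4 : ℝ) ≤ d := by exact_mod_cast hd4
  have hmn : 4 * n ≤ m := by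
    have : Fintype.card V * d ≤ D.arcCount Finset.univ Finset.univ := by
      rw [← sum_outDeg, ← Finset.card_univ, ← smul_eq_mul]
      exact Finset.card_nsmul_le_sum _ _ _ fun v _ => hdeg v
    have h : n * d ≤ m := by
      rw [hn, hmdef]
      exact_mod_cast this
    nlinarith
  have hεn : ε * n ≤ ε * m / 4 := by linarith [mul_le_mul_of_nonneg_left hmn hε.le]
  have hKpos : 0 < K := by rw [hK]; positivity
  have hΛpos : 0 < Λ := by rw [hΛ]; positivity
  obtain ⟨X₁, hX₁, hgap⟩ := exists_gap_eq_minGap (D := D) X Y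
  obtain ⟨k, hk, hk0, hsig⟩ := exists_groupedSigning hl (Δ := γ * n) (K := K) (by positivity)
    hKpos.le hY
  obtain ⟨V₁, V₂, hV, hV', r, s, hr, hrs, hmin⟩ := exists_bipartition hd hu h0 hX₁
    (M := γ * n + γ * n * K) (by positivity) (l := Λ / n) (by positivity) hsig
  refine ⟨V₁, V₂, hV, hV', ?_⟩
  set z : ℝ := ((min (D.arcCount V₁ V₂) (D.arcCount V₂ V₁) : ℕ) : ℝ)
  set hi : ℝ := ((Y.filter fun v => K < (D.deg v : ℝ)).card : ℝ) with hhi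
  set τ : ℝ := ((D.inducedOn (Y : Set V)).numEssentialTight : ℝ) with hτ
  have hgap' : |(D.gap Y X₁ (X \ X₁) : ℝ)| = (D.minGap X Y : ℝ) := by exact_mod_cast hgap
  rw [hgap'] at hmin
  have hhigh : hi * K ≤ 2 * m := card_high_mul_le
  have hhighn : hi ≤ n := by
    rw [hhi, hn]
    exact_mod_cast Finset.card_le_univ _
  have hhigh' : 2 * hi ≤ ε * m / 4 := by
    have : hi * K * ε = 16 * hi := by rw [hK]; field_simp
    linarith [mul_le_mul_of_nonneg_right hhigh hε.le]
  set M := γ * n + γ * n * K with hM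
  have hMρ : M = n * (γ * (1 + K)) := by rw [hM]; ring
  have hvar : 2 * (Λ / n) * M * m ≤ ε * m / 4 := by
    have e : 2 * (Λ / n) * M * m = 2 * Λ * m * (γ * (1 + K)) := by
      rw [hMρ]; field_simp
    rw [e]
    calc 2 * Λ * m * (γ * (1 + K)) ≤ 2 * Λ * m * (ε / (8 * Λ)) := by gcongr
      _ = ε * m / 4 := by field_simp; ring
  have hs : |s| ≤ ε * m / 4 := by
    have hsn : |s| ≤ ε * n := by
      -- The trivial bound `r ≥ -m` turns the penalised inequality into a bound on `s ^ 2`; `Λ` and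
      -- `γ` are chosen so that each of its two terms is at most `ε ^ 2 * n ^ 2 / 2`.
      apply abs_le_of_sq_le_sq _ (by positivity)
      have hb : Λ / n * s ^ 2 ≤ 2 * n + m + 2 * (Λ / n) * M * m := by linarith
      have hb' : s ^ 2 ≤ n / Λ * (2 * n + m) + 2 * M * m := by
        have := mul_le_mul_of_nonneg_left hb (by positivity : 0 ≤ n / Λ)
        have e1 : n / Λ * (Λ / n * s ^ 2) = s ^ 2 := by field_simp
        have e2 : n / Λ * (2 * n + m + 2 * (Λ / n) * M * m) =
          n / Λ * (2 * n + m) + 2 * M * m := by field_simp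
        linarith
      have hc1 : n / Λ * (2 * n + m) ≤ ε ^ 2 * n ^ 2 / 2 := by
        calc n / Λ * (2 * n + m) ≤ n / Λ * (2 * n + C * n) := by gcongr
          _ = ε ^ 2 * n ^ 2 / 2 := by rw [hΛ]; field_simp
      have hc2 : 2 * M * m ≤ ε ^ 2 * n ^ 2 / 2 := by
        rw [hMρ]
        calc 2 * (n * (γ * (1 + K))) * m ≤ 2 * (n * (ε ^ 2 / (4 * C))) * (C * n) := by gcongr
          _ = ε ^ 2 * n ^ 2 / 2 := by field_simp; ring
      rw [mul_pow]
      linarith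
    linarith
  have hmain : m + k - (D.minGap X Y : ℝ) - 3 * (ε * m / 4) ≤ 4 * z := by
    have : 0 ≤ Λ / n * s ^ 2 := by positivity
    linarith
  have hθ : (D.minGap X Y : ℝ) + D.smallSum X Y ≤ D.imbalance x₀ := by
    exact_mod_cast minGap_add_smallSum_le hd hu h0 hx₀
  have hs₀ : (D.imbalance x₀ : ℝ) ≤ Y.card := by
    exact_mod_cast imbalance_le_card hd hu h0 hx₀X
  have hb := balancedHalf_add_le hdeg hd hu
  have hτle : τ * (2 * ((d : ℝ) - 1) + 1) ≤ n + 2 * D.smallSum X Y + 2 * D.balancedHalf X := by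
    have := numEssentialTight_mul_le_balancedHalf hl hdeg hu
    rwa [hh, Nat.cast_one] at this
  have hcard : (X.card : ℝ) + Y.card = n := by
    rw [hn, ← Finset.card_univ, ← hu, Finset.card_union_of_disjoint hd]
    push_cast
    rfl
  have hg : (0 : ℝ) ≤ D.smallSum X Y := by
    have : 0 ≤ D.smallSum X Y := Finset.sum_nonneg fun x _ => D.imbalance_nonneg x
    exact_mod_cast this
  have hd1 : 0 < 2 * (d : ℝ) - 1 := by linarith
  have hfrac : ((d : ℝ) - 1) / (2 * (2 * (d : ℝ) - 1)) = 1 / 4 - 1 / (4 * (2 * d - 1)) := by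
    rw [div_sub_div _ _ (by norm_num) (mul_pos (by norm_num) hd1).ne',
      div_eq_div_iff (mul_pos (by norm_num) hd1).ne'
        (mul_pos (by norm_num) (mul_pos (by norm_num) hd1)).ne']
    ring
  rw [hfrac]
  have hγn : γ * n ≤ ε * m / 4 := (mul_le_mul_of_nonneg_right hγε hn0.le).trans hεn
  -- Inserting `2k ≥ |Y| - τ`, the bound on `τ`, `m ≥ b + d|Y|` and `θ ≤ |Y| - g` cancels `b` and
  -- leaves `(|Y| - n)/2` plus a nonnegative multiple of `g`. That is at least `-|X|/2`.
  have key : -(ε * m / 4) ≤ (2 * d - 1) * (k + m / (2 * d - 1) - D.minGap X Y) := by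
    have e : (2 * d - 1) * (k + m / (2 * d - 1) - (D.minGap X Y : ℝ)) =
      (2 * d - 1) * k + m - (2 * d - 1) * (D.minGap X Y : ℝ) := by field_simp
    rw [e]
    have k1 := mul_le_mul_of_nonneg_left hk hd1.le
    have k2 := mul_le_mul_of_nonneg_left (hθ.trans hs₀) hd1.le
    have k3 : 0 ≤ (2 * (d : ℝ) - 3) * D.smallSum X Y := mul_nonneg (by linarith) hg
    linarith
  have key' : -(ε * m / 4) ≤ k + m / (2 * d - 1) - D.minGap X Y := by
    by_contra hcon
    push Not at hcon
    have h3 : 0 ≤ ε * m / 4 := by positivity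
    have h4 := mul_lt_mul_of_pos_left hcon hd1
    have h5 := mul_le_mul_of_nonneg_right (by linarith : 1 ≤ 2 * (d : ℝ) - 1) h3
    linarith
  have e : 1 / (4 * (2 * (d : ℝ) - 1)) * m = m / (2 * d - 1) / 4 := by field_simp
  linarith

end Digraph

/-! ### Choice of constants and conclusion. -/

theorem proposition4p3 (d : ℕ) (hd : 4 ≤ d) (C ε : ℝ) (hC : 0 < C) (hε : 0 < ε) :
    ∃ γ : ℝ, 0 < γ ∧ γ < ε ∧
      ∀ (V : Type*) [Fintype V] [DecidableEq V] (D : Digraph V) (n m : ℕ),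
        D.Loopless →
        n = Fintype.card V →
        m = D.arcCount Finset.univ Finset.univ →
        (m : ℝ) ≤ C * n →
        (∀ v, d ≤ D.outDeg v) →
        ∀ X Y : Finset V, Disjoint X Y → X ∪ Y = Finset.univ →
          (X.card : ℝ) ≤ γ * n →
          D.arcCount X X = 0 →
          (∀ y ∈ Y, (D.deg y : ℝ) ≤ γ * n) →
          ((D.huge X Y).card ≤ d →
            ((D.inducedOn (Y : Set V)).numEssentialTight : ℝ) ≤
              ((n : ℝ) + 2 * (D.smallSum X Y : ℝ) + 2 * D.balancedHalf X) /
                (2 * (d : ℝ) - 2 * ((D.huge X Y).card : ℝ) + 1)) ∧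
          ((D.huge X Y).card = 1 →
            ∃ V₁ V₂ : Finset V, Disjoint V₁ V₂ ∧ V₁ ∪ V₂ = Finset.univ ∧
              (((d : ℝ) - 1) / (2 * (2 * (d : ℝ) - 1)) - ε) * (m : ℝ) ≤
                ((min (D.arcCount V₁ V₂) (D.arcCount V₂ V₁) : ℕ) : ℝ)) := by
  -- `K` is the degree above which leaves are detached, `Λ / n` is the penalty weight, and `ρ`
  -- bounds `γ * (1 + K)`, where groups have total degree at most `γ * (1 + K) * n`.
  set K : ℝ := 16 / ε with hK
  set Λ : ℝ := 2 * (2 + C) / ε ^ 2 with hΛ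
  have hKpos : 0 < K := by positivity
  have hΛpos : 0 < Λ := by positivity
  set ρ : ℝ := min (ε / (8 * Λ)) (ε ^ 2 / (4 * C)) with hρ
  have hρpos : 0 < ρ := lt_min (by positivity) (by positivity)
  have hγ1 : min (ε / 2) (ρ / (1 + K)) * (1 + K) ≤ ρ :=
    (le_div_iff₀ (by positivity)).1 (min_le_right _ _)
  have hγε : min (ε / 2) (ρ / (1 + K)) < ε := (min_le_left _ _).trans_lt (by linarith)
  refine ⟨min (ε / 2) (ρ / (1 + K)), lt_min (by positivity) (by positivity), hγε, ?_⟩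
  intro V _ _ D n m hl hn hm hmC hdeg X Y hXY hu hX h0 hY
  subst hn hm
  refine ⟨fun hh => ?_, fun hh => Digraph.le_min_arcCount hd hε (lt_min (by positivity)
    (by positivity)) hC hΛ hK hγε.le (hγ1.trans (min_le_left _ _)) (hγ1.trans (min_le_right _ _))
    hl hmC hdeg hXY hu hX h0 hY hh⟩
  have hh' : ((D.huge X Y).card : ℝ) ≤ d := by exact_mod_cast hh
  rw [le_div_iff₀ (by linarith)]
  linarith [Digraph.numEssentialTight_mul_le_balancedHalf hl hdeg hu (Y := Y)]
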